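/- **Notation.** For positive integers $k_1,\dots,k_N$ with $k_1\ge 2$ (an *admissible index*; the empty index is admissible) let $$\zeta(k_1,\dots,k_N)=\sum_{m_1>\cdots>m_N>0}\frac{1}{m_1^{k_1}\cdots m_N^{k_N}},\qquad \zeta(\emptyset)=1 .$$ Let $\mathfrak H=\mathbb Q\langle x,y\rangle$, $\mathfrak H^1=\mathbb Q+\mathfrak Hy$, $\mathfrak H^0=\mathbb Q+x\mathfrak Hy$, $z_p=x^{p-1}y$ $(p\ge1)$, and $z_k=z_{k_1}\cdots z_{k_N}$ for an index $k$. Let $Z:\mathfrak H^0\to\mathbb R$ be the $\mathbb Q$-linear map with $Z(z_{k})=\zeta(k)$ for every admissible index $k$. The $\mathbb Q$-bilinear shuffle product $\sqcup\!\sqcup$ on $\mathfrak H$ and harmonic product $\ast$ on $\mathfrak H^1$ are given by $1\mathbin{\sqcup\!\sqcup} w=w\mathbin{\sqcup\!\sqcup} 1=w$, $1\ast w=w\ast1=w$ and $$u_1w_1\mathbin{\sqcup\!\sqcup} u_2w_2=u_1(w_1\mathbin{\sqcup\!\sqcup} u_2w_2)+u_2(u_1w_1\mathbin{\sqcup\!\sqcup}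 w_2)\quad(u_1,u_2\in\{x,y\}),$$ $$z_pw_1\ast z_qw_2=z_p(w_1\ast z_qw_2)+z_q(z_pw_1\ast w_2)+z_{p+q}(w_1\ast w_2).$$ For $s=(s_{ij})_{1\le i\le j\le N}$ with $s_{ij}\in\mathbb Z_{\ge0}$ let $$\zeta_N(s;A_N)=\sum_{l_1,\dots,l_N=1}^\infty\ \prod_{1\le i\le j\le N}\Bigl(\sum_{k=i}^{N+i-j}l_k\Bigr)^{-s_{ij}}.$$ For indices $r=(r_c,\dots,r_1)$, $p=(p_a,\dots,p_1)$, $q=(q_b,\dots,q_1)$ of positive integers $(a,b,c\ge0)$ let $\zeta[r;p;q]=\zeta_{a+b+c}((d_{ij});A_{a+b+c})$, where $d_{1j}=r_{c+1-j}$ for $1\le j\le c$, $d_{1j}=p_{a+b+c+1-j}$ for $b+c+1\le j\le a+b+c$, $d_{a+1,j}=q_{a+b+c+1-j}$ for $a+c+1\le j\le a+b+c$, and $d_{ij}=0$ otherwise. Call $(r;p;q)$ *convergent* if $r_c\ge2$ when $c\ge1$, and $p$, $q$ are admissible when $c=0$. In the $\mathbb Q$-vector space with basis the formal symbols $[r;p;q]$,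 let $\mathcal P$ be the span of the following elements, for convergent triples only: the partial fraction relations (for $p=(\alpha,p')$, $q=(\beta,q')$, and with $(r,k)$ meaning that $k$ is appended to $r$) $$[r;\alpha,p';\beta,q']-\sum_{\tau=0}^{\beta-1}\binom{\alpha-1+\tau}{\tau}[r,\alpha+\tau;\ p';\ \beta-\tau,q']-\sum_{\tau=0}^{\alpha-1}\binom{\beta-1+\tau}{\tau}[r,\beta+\tau;\ \alpha-\tau,p';\ q'],$$ and the identifications $[r;p;\emptyset]-[(r,p);\emptyset;\emptyset]$ and $[r;\emptyset;q]-[(r,q);\emptyset;\emptyset]$. For a combination $w=\sum_k c_kz_k$ write $[w]=\sum_kc_k[k;\emptyset;\emptyset]$. **Theorem.** 1. The series $\zeta(k)$ for admissible $k$ and $\zeta[r;p;q]$ for convergent $(r;p;q)$ converge absolutely. 2. (The shuffle relation follows from partial fraction decompositions alone.) For $\alpha,\beta\ge1$ and real $X,Y$ with $X,Y,X+Y\ne0$, $$\frac1{X^\alpha Y^\beta}=\sum_{\tau=0}^{\beta-1}\binom{\alpha-1+\tau}{\tau}\frac1{(X+Y)^{\alpha+\tau}Y^{\beta-\tau}}+\sum_{\tau=0}^{\alpha-1}\binom{\beta-1+\tau}{\tau}\frac1{(X+Y)^{\beta+\tau}X^{\alpha-\tau}}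 .$$ Every element of $\mathcal P$ becomes $0$ under the linear map $[r;p;q]\mapsto\zeta[r;p;q]$. For admissible $k,p,q$ one has $\zeta[k;\emptyset;\emptyset]=\zeta(k)$, $\zeta[\emptyset;p;q]=\zeta(p)\zeta(q)$, and $$[\emptyset;p;q]-[z_p\mathbin{\sqcup\!\sqcup} z_q]\in\mathcal P .$$ 3. Consequently $Z(w_1\mathbin{\sqcup\!\sqcup} w_2)=Z(w_1)Z(w_2)$ for all $w_1,w_2\in\mathfrak H^0$, and $Z(z_p\mathbin{\sqcup\!\sqcup} z_q)=\zeta[\emptyset;p;q]$ for admissible $p,q$. 4. There is exactly one $\mathbb Q$-algebra homomorphism $Z^{\sqcup\!\sqcup}:(\mathfrak H^1,\sqcup\!\sqcup)\to\mathbb R[T]$ with $Z^{\sqcup\!\sqcup}(y)=T$ and $Z^{\sqcup\!\sqcup}(w)=Z(w)$ for $w\in\mathfrak H^0$, and it satisfies the extended double shuffle relation $$Z^{\sqcup\!\sqcup}(w_1\ast w_2-w_1\mathbin{\sqcup\!\sqcup} w_2)=0\qquad(w_1\in\mathfrak H^1,\ w_2\in\mathfrak H^0).$$ -/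

import Mathlib

open scoped Polynomial

noncomputable section

namespace MZV

/-! ### The algebra `ℚ⟨x, y⟩` and its words -/

/-- The two indeterminates. -/
inductive Letter
  | x
  | y

/-- `𝔥 = ℚ⟨x, y⟩`, the non-commutative polynomial algebra. -/
abbrev H : Type := FreeAlgebra ℚ Letter

/-- The indeterminate attached to a letter, as an element of `𝔥`. -/
def gen (u : Letter) : H := FreeAlgebra.ι ℚ u

/-- The word `u₁ u₂ ⋯ u_d` as an element of `𝔥`. -/
def word (w : List Letter) : H := (w.map gen).prod

/-- The words form a `ℚ`-basis of `𝔥` (see `wordBasis_apply`). -/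
def wordBasis : Module.Basis (List Letter) ℚ H :=
  (FreeAlgebra.basisFreeMonoid ℚ Letter).reindex FreeMonoid.toList

theorem wordBasis_apply (w : List Letter) : wordBasis w = word w := by
  have h : ∀ v : FreeMonoid Letter,
      (FreeAlgebra.equivMonoidAlgebraFreeMonoid (R := ℚ) (X := Letter)).symm
        (MonoidAlgebra.single v 1) = word v.toList := by
    intro v
    simp [FreeAlgebra.equivMonoidAlgebraFreeMonoid, MonoidAlgebra.lift_single,
      FreeMonoid.lift_apply, word]
    rfl
  have h2 := h (FreeMonoid.ofList w)
  simp only [FreeMonoid.toList_ofList] at h2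
  rw [← h2, wordBasis, Module.Basis.reindex_apply]
  simp [FreeAlgebra.basisFreeMonoid]

/-- `z_p = x^{p-1} y` (used for `p ≥ 1`). -/
def z (p : ℕ) : H := gen Letter.x ^ (p - 1) * gen Letter.y

/-- `z_{k₁} z_{k₂} ⋯ z_{k_N}`. -/
def zWord (k : List ℕ) : H := (k.map z).prod

/-- `𝔥¹ = ℚ + 𝔥 y`. -/
def H1 : Submodule ℚ H := 1 ⊔ LinearMap.range (LinearMap.mulRight ℚ (gen Letter.y))

/-- `𝔥⁰ = ℚ + x 𝔥 y`. -/
def H0 : Submodule ℚ H :=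
  1 ⊔ LinearMap.range (LinearMap.mulLeft ℚ (gen Letter.x) ∘ₗ LinearMap.mulRight ℚ (gen Letter.y))

/-- Auxiliary reading of a word, where `n` letters `x` have just been read. -/
def exponentsAux : ℕ → List Letter → List ℕ
  | _, [] => []
  | n, Letter.x :: w => exponentsAux (n + 1) w
  | n, Letter.y :: w => (n + 1) :: exponentsAux 0 w

/-- The index `(k₁, …, k_N)` of the word `x^{k₁-1} y ⋯ x^{k_N-1} y`
(for a word that ends in `x`, its last letters `x` are ignored). -/
def exponents (w : List Letter) : List ℕ := exponentsAux 0 w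

/-! ### Multiple zeta values and the map `Z` -/

/-- An index `(k₁, …, k_N)` of positive integers with `k₁ ≥ 2` unless `N = 0`. -/
def Admissible (k : List ℕ) : Prop := (∀ i ∈ k, 1 ≤ i) ∧ ∀ h ∈ k.head?, 2 ≤ h

/-- The term `1 / (m₁^{k₁} ⋯ m_N^{k_N})`, for `m₁ > ⋯ > m_N > 0`. -/
def mzvTerm (k : List ℕ) (m : {m : Fin k.length → ℕ // StrictAnti m ∧ ∀ i, 0 < m i}) : ℝ :=
  ∏ i, 1 / (m.1 i : ℝ) ^ (k.get i)

/-- The multiple zeta value `ζ(k₁, …, k_N)`; the value of the empty index is `1`. -/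
def mzv (k : List ℕ) : ℝ := ∑' m, mzvTerm k m

/-- The `ℚ`-linear map `Z : 𝔥⁰ → ℝ`, `z_{k₁} ⋯ z_{k_N} ↦ ζ(k₁, …, k_N)`. -/
def Z : H0 →ₗ[ℚ] ℝ :=
  (wordBasis.constr ℚ fun w => mzv (exponents w)) ∘ₗ H0.subtype

/-! ### The shuffle and the harmonic product -/

/-- The shuffle product of two words. -/
def shuffleWord : List Letter → List Letter → H
  | [], w => word w
  | u :: w, [] => word (u :: w)
  | u₁ :: w₁, u₂ :: w₂ =>
      gen u₁ * shuffleWord w₁ (u₂ :: w₂) + gen u₂ * shuffleWord (u₁ :: w₁) w₂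
termination_by w₁ w₂ => w₁.length + w₂.length

/-- The shuffle product on `𝔥`, as a `ℚ`-bilinear map. -/
def shuffle : H →ₗ[ℚ] H →ₗ[ℚ] H :=
  wordBasis.constr ℚ fun w₁ => wordBasis.constr ℚ fun w₂ => shuffleWord w₁ w₂

/-- The harmonic product of `z_{k₁} ⋯ z_{k_M}` and `z_{l₁} ⋯ z_{l_N}`. -/
def harmonicWord : List ℕ → List ℕ → H
  | [], l => zWord l
  | p :: k, [] => zWord (p :: k)
  | p :: k, q :: l =>
      z p * harmonicWord k (q :: l) + z q * harmonicWord (p :: k) l + z (p + q) * harmonicWord k l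
termination_by k l => k.length + l.length

/-- The bilinear extension of `harmonicWord`; it is only meaningful on `𝔥¹`. -/
def harmonicAux : H →ₗ[ℚ] H →ₗ[ℚ] H :=
  wordBasis.constr ℚ fun w₁ => wordBasis.constr ℚ fun w₂ =>
    harmonicWord (exponents w₁) (exponents w₂)

/-! ### The products stay in `𝔥¹` and `𝔥⁰` -/

theorem H0_le_H1 : H0 ≤ H1 := by
  refine sup_le_sup le_rfl ?_
  rintro _ ⟨h, rfl⟩
  exact ⟨gen Letter.x * h, by simp [mul_assoc]⟩

theorem one_mem_H1 : (1 : H) ∈ H1 :=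
  Submodule.mem_sup_left (Submodule.one_le.mp le_rfl)

theorem one_mem_H0 : (1 : H) ∈ H0 :=
  Submodule.mem_sup_left (Submodule.one_le.mp le_rfl)

theorem mul_gen_y_mem_H1 (h : H) : h * gen Letter.y ∈ H1 := Submodule.mem_sup_right ⟨h, rfl⟩

theorem gen_y_mem_H1 : gen Letter.y ∈ H1 := by
  simpa using mul_gen_y_mem_H1 1

theorem gen_mul_mul_gen_mem_H0 (h : H) : gen Letter.x * (h * gen Letter.y) ∈ H0 :=
  Submodule.mem_sup_right ⟨h, rfl⟩

/-- The words of `𝔥¹`: the empty word and the words that end in `y`. -/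
def IsH1Word (w : List Letter) : Prop := w = [] ∨ ∃ v, w = v ++ [Letter.y]

/-- The words of `𝔥⁰`: the empty word and the words that start with `x` and end in `y`. -/
def IsH0Word (w : List Letter) : Prop := w = [] ∨ ∃ v, w = Letter.x :: (v ++ [Letter.y])

theorem word_nil : word [] = 1 := by simp [word]

theorem word_cons (u : Letter) (w : List Letter) : word (u :: w) = gen u * word w := by
  simp [word]

theorem word_append_y (v : List Letter) :
    word (v ++ [Letter.y]) = word v * gen Letter.y := by
  simp [word]

theorem mem_span_words (h : H) : h ∈ Submodule.span ℚ (Set.range word) := by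
  have : (word : List Letter → H) = wordBasis := funext fun w => (wordBasis_apply w).symm
  rw [this, wordBasis.span_eq]
  trivial

theorem H1_le_span : H1 ≤ Submodule.span ℚ (word '' {w | IsH1Word w}) := by
  refine sup_le ?_ ?_
  · rw [Submodule.one_le]
    exact Submodule.subset_span ⟨[], Or.inl rfl, word_nil⟩
  · rintro _ ⟨h, rfl⟩
    induction mem_span_words h using Submodule.span_induction with
    | mem _ hx =>
      obtain ⟨v, rfl⟩ := hx
      exact Submodule.subset_span ⟨_, Or.inr ⟨v, rfl⟩, word_append_y v⟩
    | zero => simp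
    | add a b _ _ ha hb => rw [map_add]; exact add_mem ha hb
    | smul c a _ ha => rw [map_smul]; exact Submodule.smul_mem _ c ha

theorem H0_le_span : H0 ≤ Submodule.span ℚ (word '' {w | IsH0Word w}) := by
  refine sup_le ?_ ?_
  · rw [Submodule.one_le]
    exact Submodule.subset_span ⟨[], Or.inl rfl, word_nil⟩
  · rintro _ ⟨h, rfl⟩
    induction mem_span_words h using Submodule.span_induction with
    | mem _ hx =>
      obtain ⟨v, rfl⟩ := hx
      exact Submodule.subset_span ⟨_, Or.inr ⟨v, rfl⟩, by simp [word_cons, word_append_y]⟩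
    | zero => simp
    | add a b _ _ ha hb => rw [map_add]; exact add_mem ha hb
    | smul c a _ ha => rw [map_smul]; exact Submodule.smul_mem _ c ha

theorem shuffle_word (w₁ w₂ : List Letter) :
    shuffle (word w₁) (word w₂) = shuffleWord w₁ w₂ := by
  rw [← wordBasis_apply, ← wordBasis_apply, shuffle, Module.Basis.constr_basis,
    Module.Basis.constr_basis]

theorem shuffleWord_mem_range : ∀ w₁ w₂ : List Letter, IsH1Word w₁ → IsH1Word w₂ →
    (w₁ ≠ [] ∨ w₂ ≠ []) → ∃ h : H, shuffleWord w₁ w₂ = h * gen Letter.y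
  | [], w, _, h₂, hne => by
      rcases h₂ with rfl | ⟨v, rfl⟩
      · simp at hne
      · exact ⟨word v, by rw [shuffleWord, word_append_y]⟩
  | u :: w, [], h₁, _, _ => by
      rcases h₁ with h | ⟨v, h⟩
      · simp at h
      · exact ⟨word v, by rw [shuffleWord, h, word_append_y]⟩
  | u₁ :: w₁, u₂ :: w₂, h₁, h₂, _ => by
      have tail : ∀ (u : Letter) (w : List Letter), IsH1Word (u :: w) → IsH1Word w := by
        rintro u w (h | ⟨v, h⟩)
        · simp at h
        · cases v with
          | nil => left; simpa using congrArg List.tail h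
          | cons a v => right; exact ⟨v, by simpa using congrArg List.tail h⟩
      obtain ⟨a, ha⟩ := shuffleWord_mem_range w₁ (u₂ :: w₂) (tail _ _ h₁) h₂ (by simp)
      obtain ⟨b, hb⟩ := shuffleWord_mem_range (u₁ :: w₁) w₂ h₁ (tail _ _ h₂) (by simp)
      exact ⟨gen u₁ * a + gen u₂ * b, by rw [shuffleWord, ha, hb]; simp [add_mul, mul_assoc]⟩
termination_by w₁ w₂ => w₁.length + w₂.length

theorem shuffleWord_mem_H1 {w₁ w₂ : List Letter} (h₁ : IsH1Word w₁) (h₂ : IsH1Word w₂) :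
    shuffleWord w₁ w₂ ∈ H1 := by
  by_cases hne : w₁ ≠ [] ∨ w₂ ≠ []
  · obtain ⟨h, e⟩ := shuffleWord_mem_range w₁ w₂ h₁ h₂ hne
    rw [e]
    exact mul_gen_y_mem_H1 h
  · push Not at hne
    obtain ⟨rfl, rfl⟩ := hne
    rw [shuffleWord, word_nil]
    exact one_mem_H1

theorem shuffleWord_mem_H0 {w₁ w₂ : List Letter} (h₁ : IsH0Word w₁) (h₂ : IsH0Word w₂) :
    shuffleWord w₁ w₂ ∈ H0 := by
  rcases h₁ with rfl | ⟨v₁, rfl⟩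
  · rw [shuffleWord]
    rcases h₂ with rfl | ⟨v₂, rfl⟩
    · rw [word_nil]; exact one_mem_H0
    · rw [word_cons, word_append_y]; exact gen_mul_mul_gen_mem_H0 _
  · rcases h₂ with rfl | ⟨v₂, rfl⟩
    · rw [shuffleWord, word_cons, word_append_y]; exact gen_mul_mul_gen_mem_H0 _
    · rw [shuffleWord]
      obtain ⟨a, ha⟩ := shuffleWord_mem_range (v₁ ++ [Letter.y])
        (Letter.x :: (v₂ ++ [Letter.y])) (Or.inr ⟨v₁, rfl⟩)
        (Or.inr ⟨Letter.x :: v₂, rfl⟩) (by simp)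
      obtain ⟨b, hb⟩ := shuffleWord_mem_range (Letter.x :: (v₁ ++ [Letter.y]))
        (v₂ ++ [Letter.y]) (Or.inr ⟨Letter.x :: v₁, rfl⟩)
        (Or.inr ⟨v₂, rfl⟩) (by simp)
      rw [ha, hb]
      exact add_mem (gen_mul_mul_gen_mem_H0 a) (gen_mul_mul_gen_mem_H0 b)

theorem bilin_mem_of_span (f : H →ₗ[ℚ] H →ₗ[ℚ] H) (S : Set H) (K : Submodule ℚ H)
    (hS : ∀ a ∈ S, ∀ b ∈ S, f a b ∈ K) {a b : H} (ha : a ∈ Submodule.span ℚ S)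
    (hb : b ∈ Submodule.span ℚ S) : f a b ∈ K := by
  have h := Submodule.apply_mem_map₂ f ha hb
  rw [Submodule.map₂_span_span] at h
  refine Submodule.span_le.mpr ?_ h
  rintro _ ⟨a, ha, b, hb, rfl⟩
  exact hS a ha b hb

theorem shuffle_mem_H1 (w₁ w₂ : H1) : shuffle w₁ w₂ ∈ H1 := by
  refine bilin_mem_of_span shuffle _ H1 ?_ (H1_le_span w₁.2) (H1_le_span w₂.2)
  rintro _ ⟨a, ha, rfl⟩ _ ⟨b, hb, rfl⟩
  rw [shuffle_word]
  exact shuffleWord_mem_H1 ha hb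

theorem shuffle_mem_H0 (w₁ w₂ : H0) : shuffle w₁ w₂ ∈ H0 := by
  refine bilin_mem_of_span shuffle _ H0 ?_ (H0_le_span w₁.2) (H0_le_span w₂.2)
  rintro _ ⟨a, ha, rfl⟩ _ ⟨b, hb, rfl⟩
  rw [shuffle_word]
  exact shuffleWord_mem_H0 ha hb

theorem z_mul_mem_H1 (p : ℕ) {h : H} (hh : h ∈ H1) : z p * h ∈ H1 := by
  obtain ⟨a, ha, b, ⟨c, rfl⟩, rfl⟩ := Submodule.mem_sup.mp hh
  obtain ⟨q, rfl⟩ := Submodule.mem_one.mp ha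
  rw [mul_add]
  refine add_mem ?_ ?_
  · rw [← Algebra.commutes, ← Algebra.smul_def]
    exact Submodule.smul_mem _ _ (mul_gen_y_mem_H1 _)
  · rw [LinearMap.mulRight_apply, ← mul_assoc]
    exact mul_gen_y_mem_H1 _

theorem zWord_mem_H1 (k : List ℕ) : zWord k ∈ H1 := by
  induction k with
  | nil => simpa [zWord] using one_mem_H1
  | cons p k ih => simpa [zWord] using z_mul_mem_H1 p ih

theorem harmonicWord_mem_H1 : ∀ k l : List ℕ, harmonicWord k l ∈ H1
  | [], l => by rw [harmonicWord]; exact zWord_mem_H1 l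
  | p :: k, [] => by rw [harmonicWord]; exact zWord_mem_H1 _
  | p :: k, q :: l => by
      rw [harmonicWord]
      exact add_mem (add_mem (z_mul_mem_H1 _ (harmonicWord_mem_H1 _ _))
        (z_mul_mem_H1 _ (harmonicWord_mem_H1 _ _))) (z_mul_mem_H1 _ (harmonicWord_mem_H1 _ _))
termination_by k l => k.length + l.length

theorem harmonicAux_mem_H1 (w₁ w₂ : H) : harmonicAux w₁ w₂ ∈ H1 := by
  refine bilin_mem_of_span harmonicAux _ H1 ?_ (mem_span_words w₁) (mem_span_words w₂)
  rintro _ ⟨a, rfl⟩ _ ⟨b, rfl⟩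
  rw [← wordBasis_apply, ← wordBasis_apply, harmonicAux, Module.Basis.constr_basis,
    Module.Basis.constr_basis]
  exact harmonicWord_mem_H1 _ _

/-- The inclusion of `𝔥⁰` in `𝔥¹`. -/
def incl : H0 →ₗ[ℚ] H1 := Submodule.inclusion H0_le_H1

/-- The element `y` of `𝔥¹`. -/
def yH1 : H1 := ⟨gen Letter.y, gen_y_mem_H1⟩

/-- The shuffle product on `𝔥⁰`. -/
def shuffle0 (w₁ w₂ : H0) : H0 := ⟨shuffle w₁ w₂, shuffle_mem_H0 w₁ w₂⟩

/-- The shuffle product on `𝔥¹`. -/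
def shuffle1 (w₁ w₂ : H1) : H1 := ⟨shuffle w₁ w₂, shuffle_mem_H1 w₁ w₂⟩

/-- The harmonic product on `𝔥¹`. -/
def harmonic1 (w₁ w₂ : H1) : H1 := ⟨harmonicAux w₁ w₂, harmonicAux_mem_H1 w₁ w₂⟩

/-! ### The regularized map -/

/-- `φ` is a homomorphism of `ℚ`-algebras from `𝔥¹` with the shuffle product to `ℝ[T]`
that extends `Z` and sends `y` to `T` (it sends the unit `1 ∈ 𝔥⁰` to `Z(1) = 1`). -/
structure IsShuffleRegularization (φ : H1 →ₗ[ℚ] ℝ[X]) : Prop where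
  map_shuffle : ∀ w₁ w₂ : H1, φ (shuffle1 w₁ w₂) = φ w₁ * φ w₂
  map_y : φ yH1 = Polynomial.X
  map_incl : ∀ w : H0, φ (incl w) = Polynomial.C (Z w)

/-! ### Zeta values of root systems of type `A` -/

/-- The term of the series of the zeta-function of the root system of type `A_N` at the point
`(s_ij)_{i ≤ j}`. Indices here start at `0`, so that the inner sum over `i ≤ k ≤ N + i - j`
becomes the sum over `i ≤ k < N + i - j`. Only the `s i j` with `i ≤ j` matter. -/
def rootTerm {N : ℕ} (s : Fin N → Fin N → ℕ) (l : Fin N → ℕ+) : ℝ :=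
  ∏ i : Fin N, ∏ j ∈ Finset.Ici i,
    1 / (∑ k : Fin N with i ≤ k ∧ (k : ℕ) + j < N + i, ((l k : ℕ) : ℝ)) ^ (s i j)

/-- The value `ζ_N((s_ij); A_N)` at a point with non-negative integral coordinates. -/
def rootZeta {N : ℕ} (s : Fin N → Fin N → ℕ) : ℝ := ∑' l, rootTerm s l

/-- Three indices `r = (r_c, …, r_1)`, `p = (p_a, …, p_1)`, `q = (q_b, …, q_1)`, each written
with its largest subscript first. -/
structure Triple where
  r : List ℕ
  p : List ℕ
  q : List ℕ

/-- The number of summation variables, `a + b + c`. -/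
def Triple.size (t : Triple) : ℕ := t.p.length + t.q.length + t.r.length

/-- The point `(d_ij)` with (for `i, j` counted from `1`) `d_{1j} = r_{c+1-j}` for `1 ≤ j ≤ c`,
`d_{1j} = p_{a+b+c+1-j}` for `b+c+1 ≤ j ≤ a+b+c`, `d_{a+1,j} = q_{a+b+c+1-j}` for
`a+c+1 ≤ j ≤ a+b+c`, and `d_ij = 0` otherwise. -/
def Triple.point (t : Triple) (i j : Fin t.size) : ℕ :=
  if (i : ℕ) = 0 ∧ (j : ℕ) < t.r.length then t.r.getD j 0
  else if (i : ℕ) = 0 ∧ t.q.length + t.r.length ≤ j then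
    t.p.getD (j - (t.q.length + t.r.length)) 0
  else if (i : ℕ) = t.p.length ∧ t.p.length + t.r.length ≤ j then
    t.q.getD (j - (t.p.length + t.r.length)) 0
  else 0

/-- All entries are positive, and `r_c ≥ 2` if `c ≥ 1`, while `p_a ≥ 2` and `q_b ≥ 2`
(as far as they exist) if `c = 0`. -/
def Triple.Convergent (t : Triple) : Prop :=
  (∀ i ∈ t.r ++ t.p ++ t.q, 1 ≤ i) ∧
    if t.r = [] then Admissible t.p ∧ Admissible t.q else Admissible t.r

/-- The value `ζ_{a+b+c}((d_ij); A_{a+b+c})` attached to a triple. -/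
def Triple.zeta (t : Triple) : ℝ := rootZeta t.point

/-! ### Consequences of partial fraction decompositions -/

/-- The formal symbol of a triple, in the `ℚ`-vector space spanned by all of them. -/
def sym (r p q : List ℕ) : Triple →₀ ℚ := Finsupp.single ⟨r, p, q⟩ 1

/-- The result of decomposing the factor `1 / (X^α Y^β)`, with `X = l₁ + ⋯ + l_a` and
`Y = m₁ + ⋯ + m_b`, in each term of the series of the triple `(r; α, p; β, q)`. -/
def pfdStep (r : List ℕ) (α : ℕ) (p : List ℕ) (β : ℕ) (q : List ℕ) : Triple →₀ ℚ :=
  ∑ τ ∈ Finset.range β, ((α - 1 + τ).choose τ : ℚ) • sym (r ++ [α + τ]) p ((β - τ) :: q) +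
    ∑ τ ∈ Finset.range α, ((β - 1 + τ).choose τ : ℚ) • sym (r ++ [β + τ]) ((α - τ) :: p) q

/-- The formal relations among convergent symbols: one for every partial fraction decomposition,
and those saying that a triple with empty `q` or empty `p` is the multiple zeta value of the
concatenated index. -/
inductive PFDRelation : (Triple →₀ ℚ) → Prop
  | decompose (r : List ℕ) (α : ℕ) (p : List ℕ) (β : ℕ) (q : List ℕ)
      (h : Triple.Convergent ⟨r, α :: p, β :: q⟩) :
      PFDRelation (sym r (α :: p) (β :: q) - pfdStep r α p β q)
  | concat_left (r p : List ℕ) (h : Triple.Convergent ⟨r, p, []⟩) :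
      PFDRelation (sym r p [] - sym (r ++ p) [] [])
  | concat_right (r q : List ℕ) (h : Triple.Convergent ⟨r, [], q⟩) :
      PFDRelation (sym r [] q - sym (r ++ q) [] [])

/-- The formal relations that follow from partial fraction decompositions alone. -/
def pfdRelations : Submodule ℚ (Triple →₀ ℚ) := Submodule.span ℚ {e | PFDRelation e}

/-- The value of a formal combination of symbols. -/
def symEval : (Triple →₀ ℚ) →ₗ[ℚ] ℝ := Finsupp.linearCombination ℚ Triple.zeta

/-- The formal multiple zeta value of an element of `𝔥`: `z_{k₁} ⋯ z_{k_N}` is sent to the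
symbol of `((k₁, …, k_N); ∅; ∅)`. -/
def symOf : H →ₗ[ℚ] (Triple →₀ ℚ) := wordBasis.constr ℚ fun w => sym (exponents w) [] []

end MZV

end

noncomputable section

open scoped NNReal ENNReal PowerSeries
open Filter Topology

namespace MZV

/-! ### The recursion behind partial fractions -/

/-! All partial fraction identities here are instances of one recursion. If `F (a + 1) (b + 1) = T
(F a (b + 1)) + T (F (a + 1) b)`, with matching boundary values, then `F α β` is the binomial
combination of `eq_sum_choose_of_recursion`. For real numbers `T` is multiplication by `1 / (X +
Y)`; for products of polylogarithm series it divides the `n`-th coefficient by `n`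
(`step_mul_step`); for shuffles of words it is left multiplication by `x` (`shuffle_z_mul`).

The series of a triple is the sum of all coefficients of `tripleSeries r p q`, the product of two
polylogarithms with the variables of `r` added on top; the coefficient of `t ^ n` collects the terms
with `l₁ + ⋯ + l_N = n`. Triples, words and power series thus decompose with the same coefficients.
Each decomposition moves one entry into `r`, so the process ends at single multiple zeta values.
This gives convergence, the validity of the relations and the formal shuffle relation
(`sym_sub_symOf_mem`). For empty `r` the sum of the coefficients factors, so `Z` is multiplicative.
Power series are taken over a semifield: `ℝ≥0` allows free rearrangement in `ℝ≥0∞`, and `ℝ` serves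
the analysis.

The regularized map is the asymptotic expansion of the polylogarithm at `t = 1 - exp (-T)` as `T →
∞`, a polynomial in `T` up to errors smaller than every power. Such an expansion is unique, hence
linear and multiplicative in the function. It exists because `y` gives `-log (1 - t) = T`,
admissible words give constants, and `y` generates `𝔥¹` over `𝔥⁰` for the shuffle product; the same
generation gives uniqueness of the regularized map.

For the extended relation, the sums truncated at `m₁ < M` are multiplicative for the harmonic
product. If `b ∈ 𝔥⁰`, then the truncation of `a * b - Z(b) a` is the truncation of `a`, which is
`O(M ^ (1/4))`, times the tail of `Z(b)`, which is `O(M ^ (-1/2))`. It tends to `0`, and by Abel's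
theorem so does the corresponding polylogarithm. Its expansion is a polynomial with limit `0`, hence
zero, while shuffling with `b` multiplies the expansion by `Z(b)`. -/

/-- Pascal's rule applied to each coefficient; one of the two resulting sums is shifted by one in
`τ`. -/
theorem sum_multichoose_succ {M : Type*} [AddCommMonoid M] (A : ℕ → ℕ → M) (a b : ℕ) :
    ∑ τ ∈ Finset.range (b + 1), (a + 1).multichoose τ • A (a + 1 + τ) (b + 1 - τ) =
      ∑ τ ∈ Finset.range (b + 1), a.multichoose τ • A (a + τ + 1) (b + 1 - τ) +
        ∑ τ ∈ Finset.range b, (a + 1).multichoose τ • A (a + 1 + τ + 1) (b - τ) := by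
  rw [Finset.sum_range_succ', Finset.sum_range_succ' _ b]
  simp only [Nat.multichoose_succ_succ, add_smul, Finset.sum_add_distrib, Nat.multichoose_zero_right]
  have e1 : ∀ τ, A (a + 1 + (τ + 1)) (b + 1 - (τ + 1)) = A (a + (τ + 1) + 1) (b + 1 - (τ + 1)) :=
    fun τ => by congr 1; omega
  have e2 : ∀ τ, A (a + 1 + τ + 1) (b - τ) = A (a + (τ + 1) + 1) (b + 1 - (τ + 1)) :=
    fun τ => by congr 1 <;> omega
  simp only [e1, e2, add_zero]
  abel

/-- Both sides obey the same recursion, because `T` raises the first index of `A` and of `B`. No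
subtraction is used, so the lemma also covers power series over `ℝ≥0`. -/
theorem eq_sum_choose_of_recursion {M : Type*} [AddCommMonoid M] (T : M →+ M)
    (A B F : ℕ → ℕ → M)
    (hA : ∀ i j, 1 ≤ i → A (i + 1) j = T (A i j)) (hB : ∀ i j, 1 ≤ i → B (i + 1) j = T (B i j))
    (h11 : F 1 1 = A 1 1 + B 1 1)
    (h1 : ∀ b, 1 ≤ b → F 1 (b + 1) = A 1 (b + 1) + T (F 1 b))
    (h2 : ∀ a, 1 ≤ a → F (a + 1) 1 = T (F a 1) + B 1 (a + 1))
    (h : ∀ a b, 1 ≤ a → 1 ≤ b → F (a + 1) (b + 1) = T (F a (b + 1)) + T (F (a + 1) b))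
    {α β : ℕ} (hα : 1 ≤ α) (hβ : 1 ≤ β) :
    F α β = ∑ τ ∈ Finset.range β, (α - 1 + τ).choose τ • A (α + τ) (β - τ) +
      ∑ τ ∈ Finset.range α, (β - 1 + τ).choose τ • B (β + τ) (α - τ) := by
  obtain ⟨a, rfl⟩ := Nat.exists_eq_add_of_le' hα
  obtain ⟨b, rfl⟩ := Nat.exists_eq_add_of_le' hβ
  -- In terms of `multichoose`, Pascal's rule needs no truncated subtraction.
  have hmc : ∀ n k : ℕ, (n + 1 - 1 + k).choose k = (n + 1).multichoose k := fun n k => by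
    rw [Nat.multichoose_eq]; congr 1; omega
  simp only [hmc]
  let S (C : ℕ → ℕ → M) (a b : ℕ) : M :=
    ∑ τ ∈ Finset.range b, a.multichoose τ • C (a + τ) (b - τ)
  -- `S'` is `S` with the first index of `C` raised by one. For positive `a` this is `T` applied to
  -- `S` (`hT`); for `a = 0` only the term `τ = 0` survives (`hz`), which is the boundary value.
  let S' (C : ℕ → ℕ → M) (a b : ℕ) : M :=
    ∑ τ ∈ Finset.range b, a.multichoose τ • C (a + τ + 1) (b - τ)
  have hS : ∀ C a b, S C (a + 1) (b + 1) = S' C a (b + 1) + S' C (a + 1) b :=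
    fun C a b => sum_multichoose_succ C a b
  have hT : ∀ C : ℕ → ℕ → M, (∀ i j, 1 ≤ i → C (i + 1) j = T (C i j)) → ∀ c n : ℕ,
      S' C (c + 1) n = T (S C (c + 1) n) := by
    intro C hC c n
    rw [map_sum]
    refine Finset.sum_congr rfl fun τ _ => ?_
    rw [hC _ _ (by omega), map_nsmul]
  have hz : ∀ (C : ℕ → ℕ → M) (d : ℕ), S' C 0 (d + 1) = C 1 (d + 1) := by
    intro C d
    simp only [S']
    rw [Finset.sum_range_succ']
    simp
  have h0 : ∀ (C : ℕ → ℕ → M) (d : ℕ), S' C d 0 = 0 := fun C d => rfl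
  change F (a + 1) (b + 1) = S A (a + 1) (b + 1) + S B (b + 1) (a + 1)
  clear hα hβ
  induction a generalizing b with
  | zero =>
    induction b with
    | zero => rw [hS, hS, hz, hz, h0, h0, add_zero, add_zero]; exact h11
    | succ b ih =>
      rw [hS A, hS B, hz, h0, h1 _ (by omega), ih, map_add, hT A hA, hT B hB, add_zero]
      exact (add_assoc _ _ _).symm
  | succ a iha =>
    induction b with
    | zero =>
      rw [hS A, hS B, hz, h0, h2 _ (by omega), iha, map_add, hT A hA, hT B hB, add_zero, add_assoc,
        add_comm (B _ _)]
    | succ b ihb =>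
      rw [hS A, hS B, h _ _ (by omega) (by omega), iha, ihb, map_add, map_add, hT A hA, hT A hA,
        hT B hB, hT B hB]
      abel

/-- The recursion is `1 / (X * Y) = (1 / X + 1 / Y) / (X + Y)`, multiplied by further powers of `1 /
X` and `1 / Y`. -/
theorem one_div_pow_mul_pow {α β : ℕ} {X Y : ℝ} (hα : 1 ≤ α) (hβ : 1 ≤ β) (hX : X ≠ 0)
    (hY : Y ≠ 0) (hXY : X + Y ≠ 0) :
    1 / (X ^ α * Y ^ β) =
        ∑ τ ∈ Finset.range β,
            ((α - 1 + τ).choose τ : ℝ) * (1 / ((X + Y) ^ (α + τ) * Y ^ (β - τ))) +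
          ∑ τ ∈ Finset.range α,
            ((β - 1 + τ).choose τ : ℝ) * (1 / ((X + Y) ^ (β + τ) * X ^ (α - τ))) := by
  have := eq_sum_choose_of_recursion (AddMonoidHom.mulLeft (1 / (X + Y)))
    (fun i j => 1 / ((X + Y) ^ i * Y ^ j)) (fun i j => 1 / ((X + Y) ^ i * X ^ j))
    (fun i j => 1 / (X ^ i * Y ^ j)) (fun i j _ => by simp; field_simp; ring)
    (fun i j _ => by simp; field_simp; ring) (by field_simp)
    (fun b _ => by simp; field_simp; ring) (fun b _ => by simp; field_simp; ring)
    (fun a b _ _ => by simp; field_simp; ring) hα hβ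
  simpa only [nsmul_eq_mul] using this

/-! ### Power series of multiple polylogarithms -/

section PowerSeries

variable {R : Type*} [Semifield R]

/-- Multiplication of the `n`-th coefficient by `n ^ (-k)`. -/
def scale (k : ℕ) : R⟦X⟧ →ₗ[R] R⟦X⟧ where
  toFun f := PowerSeries.mk fun n => ((n : R)⁻¹) ^ k * PowerSeries.coeff n f
  map_add' f g := by ext n; simp [mul_add]
  map_smul' c f := by ext n; simp [mul_left_comm]

@[simp] theorem coeff_scale (k n : ℕ) (f : R⟦X⟧) :
    PowerSeries.coeff n (scale k f) = ((n : R)⁻¹) ^ k * PowerSeries.coeff n f := by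
  simp [scale]

theorem scale_scale (k l : ℕ) (f : R⟦X⟧) : scale k (scale l f) = scale (k + l) f := by
  ext n; simp [pow_add, mul_assoc]

theorem scale_zero (f : R⟦X⟧) : scale 0 f = f := by ext n; simp

/-- The power series `t / (1 - t)`. -/
def geom : R⟦X⟧ := PowerSeries.mk fun n => if n = 0 then 0 else 1

theorem coeff_geom_mul (n : ℕ) (f : R⟦X⟧) :
    PowerSeries.coeff n (geom * f) = ∑ m ∈ Finset.range n, PowerSeries.coeff m f := by
  rw [mul_comm, PowerSeries.coeff_mul,
    Finset.Nat.sum_antidiagonal_eq_sum_range_succ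
      (fun i j => PowerSeries.coeff i f * PowerSeries.coeff j geom), Nat.succ_eq_add_one,
    Finset.sum_range_succ]
  simp only [geom, PowerSeries.coeff_mk, tsub_self, if_true, mul_zero, add_zero]
  refine Finset.sum_congr rfl fun m hm => ?_
  have := Finset.mem_range.mp hm
  rw [if_neg (by omega), mul_one]

/-- Adding a summation variable, with exponent `k`, on top. -/
def step (k : ℕ) : R⟦X⟧ →ₗ[R] R⟦X⟧ := scale k ∘ₗ LinearMap.mulLeft R geom

theorem step_apply (k : ℕ) (f : R⟦X⟧) : step k f = scale k (geom * f) := rfl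

theorem coeff_step (k n : ℕ) (f : R⟦X⟧) :
    PowerSeries.coeff n (step k f) =
      ((n : R)⁻¹) ^ k * ∑ m ∈ Finset.range n, PowerSeries.coeff m f := by
  rw [step_apply, coeff_scale, coeff_geom_mul]

/-- Adding several summation variables on top. -/
def chain : List ℕ → R⟦X⟧ →ₗ[R] R⟦X⟧
  | [] => LinearMap.id
  | k :: r => step k ∘ₗ chain r

@[simp] theorem chain_nil (f : R⟦X⟧) : chain [] f = f := rfl

@[simp] theorem chain_cons (k : ℕ) (r : List ℕ) (f : R⟦X⟧) :
    chain (k :: r) f = step k (chain r f) := rfl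

theorem chain_append (r s : List ℕ) (f : R⟦X⟧) : chain (r ++ s) f = chain r (chain s f) := by
  induction r with
  | nil => rfl
  | cons k r ih => simp [ih]

/-- The power series `∑ t ^ m₁ / (m₁ ^ k₁ ⋯ m_N ^ k_N)` over `m₁ > ⋯ > m_N > 0`. -/
def polylog (k : List ℕ) : R⟦X⟧ := chain k 1

@[simp] theorem polylog_nil : polylog [] = (1 : R⟦X⟧) := rfl

@[simp] theorem polylog_cons (k : ℕ) (l : List ℕ) :
    polylog (k :: l) = (step k (polylog l) : R⟦X⟧) := rfl

theorem coeff_zero_geom_mul (f : R⟦X⟧) : PowerSeries.coeff 0 (geom * f) = 0 := by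
  simp [coeff_geom_mul]

theorem coeff_zero_scale {f : R⟦X⟧} (hf : PowerSeries.coeff 0 f = 0) (k : ℕ) :
    PowerSeries.coeff 0 (scale k f) = 0 := by
  rw [coeff_scale, hf, mul_zero]

variable [CharZero R]

/-- The Leibniz rule for `t d/dt`, in integrated form. -/
theorem scale_one_mul_scale_one {f g : R⟦X⟧} (hf : PowerSeries.coeff 0 f = 0)
    (hg : PowerSeries.coeff 0 g = 0) :
    scale 1 f * scale 1 g = scale 1 (f * scale 1 g) + scale 1 (scale 1 f * g) := by
  ext n
  simp only [map_add, coeff_scale, PowerSeries.coeff_mul, Finset.mul_sum, pow_one]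
  rw [← Finset.sum_add_distrib]
  refine Finset.sum_congr rfl fun ⟨i, j⟩ hij => ?_
  obtain rfl : i + j = n := by simpa using hij
  -- For positive indices this is `1 / (i j) = (1 / i + 1 / j) / (i + j)`. Index `0`, where the
  -- inverse is `0` by convention, drops out since the constant coefficients vanish.
  rcases Nat.eq_zero_or_pos i with rfl | hi
  · simp [hf]
  rcases Nat.eq_zero_or_pos j with rfl | hj
  · simp [hg]
  have h1 : (i : R) ≠ 0 := by exact_mod_cast hi.ne'
  have h2 : (j : R) ≠ 0 := by exact_mod_cast hj.ne'
  have h3 : ((i + j : ℕ) : R) ≠ 0 := by exact_mod_cast (by omega)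
  push_cast at h3 ⊢
  field_simp

theorem scale_mul_scale {u v : R⟦X⟧} (hu : PowerSeries.coeff 0 u = 0)
    (hv : PowerSeries.coeff 0 v = 0) {α β : ℕ} (hα : 1 ≤ α) (hβ : 1 ≤ β) :
    scale α u * scale β v =
      ∑ τ ∈ Finset.range β, (α - 1 + τ).choose τ • scale (α + τ) (u * scale (β - τ) v) +
      ∑ τ ∈ Finset.range α, (β - 1 + τ).choose τ • scale (β + τ) (scale (α - τ) u * v) := by
  have key : ∀ a b, scale (a + 1) u * scale (b + 1) v =
      scale 1 (scale a u * scale (b + 1) v) + scale 1 (scale (a + 1) u * scale b v) := by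
    intro a b
    have := scale_one_mul_scale_one (coeff_zero_scale hu a) (coeff_zero_scale hv b)
    simpa only [scale_scale, add_comm 1] using this
  refine eq_sum_choose_of_recursion (scale 1 : R⟦X⟧ →ₗ[R] R⟦X⟧).toAddMonoidHom
    (fun i j => scale i (u * scale j v)) (fun i j => scale i (scale j u * v))
    (fun i j => scale i u * scale j v) ?_ ?_ ?_ ?_ ?_ ?_ hα hβ
  · intro i j _; simp [scale_scale, add_comm 1]
  · intro i j _; simp [scale_scale, add_comm 1]
  · simpa [scale_zero] using key 0 0
  · intro b _; simpa [scale_zero] using key 0 b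
  · intro a _; simpa [scale_zero] using key a 0
  · intro a b _ _; exact key a b

/-- The partial fraction decomposition for products of multiple polylogarithms. -/
theorem step_mul_step (f g : R⟦X⟧) {α β : ℕ} (hα : 1 ≤ α) (hβ : 1 ≤ β) :
    step α f * step β g =
      ∑ τ ∈ Finset.range β, (α - 1 + τ).choose τ • step (α + τ) (f * step (β - τ) g) +
      ∑ τ ∈ Finset.range α, (β - 1 + τ).choose τ • step (β + τ) (step (α - τ) f * g) := by
  simp only [step_apply]
  rw [scale_mul_scale (coeff_zero_geom_mul f) (coeff_zero_geom_mul g) hα hβ]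
  simp only [mul_assoc, mul_left_comm geom]

end PowerSeries

/-! ### Sums over chains -/

/-- A coefficient, as an extended non-negative number. -/
abbrev ecoeff (n : ℕ) (f : ℝ≥0⟦X⟧) : ℝ≥0∞ := ((PowerSeries.coeff n f : ℝ≥0) : ℝ≥0∞)

theorem coe_coeff_step (k n : ℕ) (f : ℝ≥0⟦X⟧) :
    ecoeff n (step k f) =
      ((((n : ℝ≥0)⁻¹) ^ k : ℝ≥0) : ℝ≥0∞) *
        ∑' m, if m < n then ecoeff m f else 0 := by
  rw [ecoeff, coeff_step, ENNReal.coe_mul, tsum_eq_sum (s := Finset.range n)]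
  · rw [ENNReal.ofNNReal_finsetSum]
    congr 1
    exact Finset.sum_congr rfl fun m hm => by rw [if_pos (Finset.mem_range.mp hm)]
  · intro m hm
    rw [if_neg (by simpa using hm)]

/-- Tonelli: adding a variable on top of `f` amounts to changing the test function `h`. Keeping `h`
arbitrary is what lets the later inductions on the index run. -/
theorem tsum_coeff_step (k : ℕ) (f : ℝ≥0⟦X⟧) (h : ℕ → ℝ≥0∞) :
    ∑' n, ecoeff n (step k f) * h n =
      ∑' m, ecoeff m f *
        ∑' n : ℕ, if m < n then ((((n : ℝ≥0)⁻¹) ^ k : ℝ≥0) : ℝ≥0∞) * h n else 0 := by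
  simp only [coe_coeff_step, ← ENNReal.tsum_mul_left, ← ENNReal.tsum_mul_right]
  rw [ENNReal.tsum_comm]
  refine tsum_congr fun m => tsum_congr fun n => ?_
  split_ifs
  · ring
  · simp

theorem tsum_pnat_add (m : ℕ) (g : ℕ → ℝ≥0∞) :
    ∑' x : ℕ+, g (m + x) = ∑' n : ℕ, if m < n then g n else 0 := by
  have hi : Function.Injective fun x : ℕ+ => m + (x : ℕ) :=
    fun x y hxy => PNat.coe_injective (Nat.add_left_cancel hxy)
  rw [← hi.tsum_eq]
  · refine tsum_congr fun x => ?_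
    have := x.pos
    rw [if_pos (by omega)]
  · intro n hn
    have hmn : m < n := by
      by_contra hc
      simp [hc] at hn
    exact ⟨⟨n - m, by omega⟩, by simp; omega⟩

/-- The factors `(l₁ + ⋯ + l_{N-m}) ^ (-r_m)`. -/
def tower (r : List ℕ) {N : ℕ} (l : Fin N → ℕ+) : ℝ≥0 :=
  ∏ m : Fin r.length,
    (((∑ k : Fin N with k.val + m.val < N, (l k : ℕ) : ℕ) : ℝ≥0)⁻¹) ^ r.get m

theorem tower_nil {N : ℕ} (l : Fin N → ℕ+) : tower [] l = 1 := by simp [tower]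

/-- The last variable occurs only in the factor `m = 0`, the sum of all variables; the other factors
are those of the shorter tower. -/
theorem tower_snoc (a : ℕ) (r : List ℕ) {N : ℕ} (l : Fin N → ℕ+) (x : ℕ+) :
    tower (a :: r) (Fin.snoc l x : Fin (N + 1) → ℕ+) =
      ((((∑ k, (l k : ℕ)) + x : ℕ) : ℝ≥0)⁻¹) ^ a * tower r l := by
  unfold tower
  refine (Fin.prod_univ_succ _).trans ?_
  congr 1
  · simp only [Finset.sum_filter, Fin.sum_univ_castSucc, Fin.snoc_castSucc, Fin.snoc_last]
    simp only [Fin.val_zero, Fin.val_castSucc, Fin.val_last, add_zero, lt_add_iff_pos_right,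
      zero_lt_one, if_true]
    congr 4
    exact Finset.sum_congr rfl fun k _ => if_pos (by omega)
  · refine Finset.prod_congr rfl fun m _ => ?_
    simp only [Finset.sum_filter, Fin.sum_univ_castSucc, Fin.snoc_castSucc, Fin.snoc_last]
    simp only [Fin.val_succ, Fin.val_castSucc, Fin.val_last]
    rw [if_neg (by omega), add_zero]
    refine congrArg (fun s : ℕ => ((s : ℝ≥0)⁻¹) ^ r.get m) ?_
    exact Finset.sum_congr rfl fun k _ => if_congr (by omega) rfl rfl

theorem tsum_snoc {N : ℕ} (F : (Fin (N + 1) → ℕ+) → ℝ≥0∞) :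
    ∑' l, F l = ∑' l : Fin N → ℕ+, ∑' x : ℕ+, F (Fin.snoc l x) := by
  rw [← (Fin.snocEquiv fun _ : Fin (N + 1) => ℕ+).tsum_eq, ENNReal.tsum_prod', ENNReal.tsum_comm]
  rfl

theorem sum_snoc {N : ℕ} (l : Fin N → ℕ+) (x : ℕ+) :
    ∑ k, ((Fin.snoc l x : Fin (N + 1) → ℕ+) k : ℕ) = (∑ k, (l k : ℕ)) + x := by
  simp [Fin.sum_univ_castSucc]

/-- Summation over the last variable. -/
theorem tsum_tower_snoc (a : ℕ) (r : List ℕ) {N : ℕ} (G : (Fin N → ℕ+) → ℝ≥0∞) (f : ℝ≥0⟦X⟧)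
    (hf : ∀ h : ℕ → ℝ≥0∞, ∑' l : Fin N → ℕ+, (tower r l * G l) * h (∑ k, (l k : ℕ)) =
      ∑' n, ecoeff n f * h n) (h : ℕ → ℝ≥0∞) :
    ∑' l : Fin (N + 1) → ℕ+, (tower (a :: r) l * G fun k => l k.castSucc) * h (∑ k, (l k : ℕ)) =
      ∑' n, ecoeff n (step a f) * h n := by
  rw [tsum_coeff_step, ← hf, tsum_snoc]
  refine tsum_congr fun l => ?_
  rw [← tsum_pnat_add _ fun n => ((((n : ℝ≥0)⁻¹) ^ a : ℝ≥0) : ℝ≥0∞) * h n,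
    ← ENNReal.tsum_mul_left]
  refine tsum_congr fun x => ?_
  rw [tower_snoc, sum_snoc, ENNReal.coe_mul]
  simp only [Fin.snoc_castSucc]
  ring

/-- The coefficient of `t ^ n` in the polylogarithm collects the tuples `l` with sum `n`; the
partial sums of `l` are the decreasing variables of the multiple zeta value. -/
theorem tsum_tower (k : List ℕ) (h : ℕ → ℝ≥0∞) :
    ∑' l : Fin k.length → ℕ+, (tower k l : ℝ≥0∞) * h (∑ i, (l i : ℕ)) =
      ∑' n, ecoeff n (polylog k) * h n := by
  induction k generalizing h with
  | nil =>
    rw [tsum_eq_single (0 : ℕ) (by intro n hn; simp [PowerSeries.coeff_one, hn])]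
    simp only [List.length_nil, tower_nil]
    rw [tsum_eq_single default (by intro l hl; exact absurd (Subsingleton.elim _ _) hl)]
    simp [ecoeff]
  | cons a k ih =>
    have := tsum_tower_snoc a k (fun _ => 1) (polylog k) (by simpa using ih) h
    simpa using this

/-- The term of the series of a triple. -/
def tripleTerm (r p q : List ℕ) (l : Fin (p.length + q.length + r.length) → ℕ+) : ℝ≥0 :=
  tower r l * (tower p (fun k => l (Fin.castAdd _ (Fin.castAdd _ k))) *
    tower q fun k => l (Fin.castAdd _ (Fin.natAdd _ k)))

theorem tsum_coeff_mul (f g : ℝ≥0⟦X⟧) (h : ℕ → ℝ≥0∞) :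
    ∑' n, ecoeff n (f * g) * h n =
      ∑' i, ecoeff i f * ∑' j, ecoeff j g * h (i + j) := by
  simp only [← ENNReal.tsum_mul_left]
  rw [← ENNReal.tsum_prod,
    ← (Finset.HasAntidiagonal.sigmaAntidiagonalEquivProd (A := ℕ)).tsum_eq, ENNReal.tsum_sigma']
  refine tsum_congr fun n => ?_
  rw [ecoeff, PowerSeries.coeff_mul, tsum_fintype, ENNReal.ofNNReal_finsetSum, Finset.sum_mul,
    ← Finset.sum_coe_sort]
  refine Finset.sum_congr rfl fun ij _ => ?_
  have := Finset.HasAntidiagonal.mem_antidiagonal.mp ij.2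
  simp [this, mul_assoc]

/-- Without `r` the variables of `p` and of `q` are independent, so the generating series is a
product; each entry of `r` then contributes one further last variable. -/
theorem tsum_tripleTerm (r p q : List ℕ) (h : ℕ → ℝ≥0∞) :
    ∑' l, (tripleTerm r p q l : ℝ≥0∞) * h (∑ i, (l i : ℕ)) =
      ∑' n, ecoeff n (chain r (polylog p * polylog q)) * h n := by
  induction r generalizing h with
  | nil =>
    rw [chain_nil, tsum_coeff_mul]
    rw [← tsum_tower]
    change ∑' l : Fin (p.length + q.length) → ℕ+, _ = _
    rw [← (Fin.appendEquiv p.length q.length).tsum_eq, ENNReal.tsum_prod']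
    refine tsum_congr fun l => ?_
    rw [← tsum_tower q fun j => h (_ + j), ← ENNReal.tsum_mul_left]
    refine tsum_congr fun l' => ?_
    have e1 : ∑ i, (((Fin.appendEquiv p.length q.length) (l, l') i : ℕ+) : ℕ) =
        ∑ i, (l i : ℕ) + ∑ i, (l' i : ℕ) := by
      simp [Fin.sum_univ_add]
    have e2 : tripleTerm [] p q ((Fin.appendEquiv p.length q.length) (l, l')) =
        tower p l * tower q l' := by
      have c1 : (fun k => (Fin.appendEquiv p.length q.length) (l, l') (Fin.castAdd _ k)) = l := by
        ext k; simp
      have c2 : (fun k => (Fin.appendEquiv p.length q.length) (l, l') (Fin.natAdd _ k)) = l' := by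
        ext k; simp
      rw [tripleTerm, tower_nil, one_mul]
      exact congrArg₂ (· * ·) (congrArg _ c1) (congrArg _ c2)
    rw [e2]
    change _ * h (∑ i, (((Fin.appendEquiv p.length q.length) (l, l') i : ℕ+) : ℕ)) = _
    rw [e1, ENNReal.coe_mul, mul_assoc]
  | cons a r ih =>
    have := tsum_tower_snoc a r (fun l => (tower p (fun k => l (Fin.castAdd _ (Fin.castAdd _ k))) *
      tower q fun k => l (Fin.castAdd _ (Fin.natAdd _ k)) : ℝ≥0))
      (chain r (polylog p * polylog q)) (by simpa [tripleTerm] using ih) h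
    rw [chain_cons, ← this]
    refine tsum_congr fun l => ?_
    rw [tripleTerm, ENNReal.coe_mul]
    rfl

/-! ### The terms of the defining series -/

theorem prod_prod_pow_ite {N : ℕ} (x : Fin N → Fin N → ℝ) (i₀ j₀ : Fin N) (hij : i₀ ≤ j₀) (e : ℕ) :
    ∏ i, ∏ j ∈ Finset.Ici i, x i j ^ (if i = i₀ ∧ j = j₀ then e else 0) = x i₀ j₀ ^ e := by
  rw [Finset.prod_eq_single i₀, Finset.prod_eq_single j₀]
  · simp
  · intro j _ hj; simp [hj]
  · intro h; exact absurd (Finset.mem_Ici.mpr hij) h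
  · intro i _ hi; simp [hi]
  · simp

theorem sum_get_ite (L : List ℕ) (d j : ℕ) (P : Prop) [Decidable P] :
    ∑ m : Fin L.length, (if P ∧ j = d + m then L.get m else 0) =
      if P ∧ d ≤ j ∧ j < d + L.length then L.getD (j - d) 0 else 0 := by
  split_ifs with h
  · obtain ⟨hP, h1, h2⟩ := h
    rw [Finset.sum_eq_single ⟨j - d, by omega⟩]
    · rw [if_pos ⟨hP, by simp; omega⟩]
      exact (List.getD_eq_getElem _ _ _).symm
    · intro m _ hm
      rw [if_neg]
      rintro ⟨-, h3⟩
      exact hm (Fin.ext (by simp; omega))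
    · simp
  · refine Finset.sum_eq_zero fun m _ => if_neg ?_
    rintro ⟨hP, h3⟩
    exact h ⟨hP, by omega, by omega⟩

/-- The three cases have disjoint supports. Written as a sum of indicators, the exponent splits the
term of the root system into one factor for each of `r`, `p` and `q`. -/
theorem point_eq (r p q : List ℕ) (i j : Fin (Triple.size ⟨r, p, q⟩)) :
    Triple.point ⟨r, p, q⟩ i j =
      (∑ m : Fin r.length, if i.val = 0 ∧ j.val = 0 + m then r.get m else 0) +
      (∑ m : Fin p.length, if i.val = 0 ∧ j.val = q.length + r.length + m then p.get m else 0) +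
      ∑ m : Fin q.length,
        if i.val = p.length ∧ j.val = p.length + r.length + m then q.get m else 0 := by
  have hj := j.2
  unfold Triple.size at hj
  simp only at hj
  rw [sum_get_ite, sum_get_ite, sum_get_ite]
  unfold Triple.point
  simp only
  split_ifs <;> first | omega | simp

theorem one_div_sum_eq {N : ℕ} (l : Fin N → ℕ+) (P : Fin N → Prop) [DecidablePred P] (e : ℕ) :
    (1 / (∑ k : Fin N with P k, ((l k : ℕ) : ℝ))) ^ e =
      (((((∑ k : Fin N with P k, (l k : ℕ) : ℕ) : ℝ≥0)⁻¹) ^ e : ℝ≥0) : ℝ) := by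
  push_cast
  rw [one_div]

theorem rootTerm_point (r p q : List ℕ) (l : Fin (Triple.size ⟨r, p, q⟩) → ℕ+) :
    rootTerm (Triple.point ⟨r, p, q⟩) l = (tripleTerm r p q l : ℝ) := by
  have hsize : Triple.size ⟨r, p, q⟩ = p.length + q.length + r.length := rfl
  unfold rootTerm
  simp only [← one_div_pow]
  simp only [point_eq, pow_add, Finset.prod_mul_distrib, ← Finset.prod_pow_eq_pow_sum]
  -- A list placed in row `i₀` from column `d` on contributes one factor per entry; `i₀ ≤ d` keeps
  -- these positions in the range `i ≤ j`.
  have hcol : ∀ (L : List ℕ) (i₀ d : ℕ) (_ : i₀ ≤ d)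
      (_ : d + L.length ≤ Triple.size ⟨r, p, q⟩) (x : Fin _ → Fin _ → ℝ),
      (∏ i : Fin (Triple.size ⟨r, p, q⟩), ∏ j ∈ Finset.Ici i, ∏ m : Fin L.length,
        x i j ^ (if i.val = i₀ ∧ j.val = d + m then L.get m else 0)) =
      ∏ m : Fin L.length, x ⟨i₀, by have := m.2; omega⟩ ⟨d + m, by have := m.2; omega⟩ ^ L.get m := by
    intro L i₀ d h1 h2 x
    have : ∀ i : Fin (Triple.size ⟨r, p, q⟩), (∏ j ∈ Finset.Ici i, ∏ m : Fin L.length,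
        x i j ^ (if i.val = i₀ ∧ j.val = d + m then L.get m else 0)) =
        ∏ m : Fin L.length, ∏ j ∈ Finset.Ici i,
          x i j ^ (if i.val = i₀ ∧ j.val = d + m then L.get m else 0) := fun i =>
      Finset.prod_comm
    simp only [this]
    rw [Finset.prod_comm]
    refine Finset.prod_congr rfl fun m _ => ?_
    rw [← prod_prod_pow_ite x ⟨i₀, by have := m.2; omega⟩ ⟨d + m, by have := m.2; omega⟩
      (by simp; omega)]
    simp [Fin.ext_iff]
  rw [hcol r 0 0 le_rfl (by omega), hcol p 0 (q.length + r.length) (by omega) (by omega),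
    hcol q p.length (p.length + r.length) (by omega) (by omega)]
  simp only [one_div_sum_eq, tripleTerm, tower, NNReal.coe_mul, NNReal.coe_prod, mul_assoc]
  congr 1
  · refine Finset.prod_congr rfl fun m _ => ?_
    refine congrArg (fun s : ℕ => (((((s : ℕ) : ℝ≥0)⁻¹) ^ r.get m : ℝ≥0) : ℝ)) ?_
    refine Finset.sum_congr (Finset.filter_congr fun k _ => ?_) fun _ _ => rfl
    simp [Fin.le_def]
    rfl
  congr 1
  · refine Finset.prod_congr rfl fun m _ => ?_
    refine congrArg (fun s : ℕ => (((((s : ℕ) : ℝ≥0)⁻¹) ^ p.get m : ℝ≥0) : ℝ)) ?_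
    simp only [Finset.sum_filter, Fin.le_def]
    change ∑ k : Fin (p.length + q.length + r.length), _ = _
    -- In row `0` and column `b + c + m` only the `k < a - m` occur, so the blocks of `q` and `r`
    -- contribute nothing.
    rw [Fin.sum_univ_add, Fin.sum_univ_add, Finset.sum_eq_zero (s := Finset.univ (α := Fin r.length)),
      Finset.sum_eq_zero (s := Finset.univ (α := Fin q.length)), add_zero, add_zero]
    · refine Finset.sum_congr rfl fun k _ => if_congr ?_ rfl rfl
      simp
      omega
    · intro k _
      rw [if_neg]
      simp
      omega
    · intro k _
      rw [if_neg]
      simp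
      omega
  · refine Finset.prod_congr rfl fun m _ => ?_
    refine congrArg (fun s : ℕ => (((((s : ℕ) : ℝ≥0)⁻¹) ^ q.get m : ℝ≥0) : ℝ)) ?_
    simp only [Finset.sum_filter, Fin.le_def]
    change ∑ k : Fin (p.length + q.length + r.length), _ = _
    -- In row `a` and column `a + c + m` only `a ≤ k < a + b - m` remains, inside the block of `q`.
    rw [Fin.sum_univ_add, Fin.sum_univ_add, Finset.sum_eq_zero (s := Finset.univ (α := Fin r.length)),
      Finset.sum_eq_zero (s := Finset.univ (α := Fin p.length)), add_zero, zero_add]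
    · refine Finset.sum_congr rfl fun k _ => if_congr ?_ rfl rfl
      simp
      omega
    · intro k _
      rw [if_neg]
      simp
    · intro k _
      rw [if_neg]
      simp
      omega

/-! ### Multiple zeta values as sums over decreasing chains -/

/-- The largest summation variable, or `0` if there is none. -/
def topEntry : {N : ℕ} → (Fin N → ℕ) → ℕ
  | 0, _ => 0
  | _ + 1, m => m 0

theorem le_topEntry {N : ℕ} {m : Fin N → ℕ} (hm : StrictAnti m) (j : Fin N) :
    m j ≤ topEntry m := by
  cases N with
  | zero => exact j.elim0
  | succ N => exact hm.antitone (Fin.zero_le j)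

/-- The value `0` of `topEntry` on the empty tuple turns `topEntry m < n` into positivity of `n`
there. -/
theorem strictAnti_cons_iff {N : ℕ} (n : ℕ) (m : Fin N → ℕ) :
    (StrictAnti (Fin.cons n m : Fin (N + 1) → ℕ) ∧ ∀ i, 0 < (Fin.cons n m : Fin (N + 1) → ℕ) i) ↔
      topEntry m < n ∧ StrictAnti m ∧ ∀ i, 0 < m i := by
  constructor
  · rintro ⟨h, hp⟩
    refine ⟨?_, fun i j hij => by simpa using h (Fin.succ_lt_succ_iff.mpr hij),
      fun i => by simpa using hp i.succ⟩
    cases N with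
    | zero => simpa [topEntry] using hp 0
    | succ N => simpa [topEntry] using h (Fin.succ_pos (0 : Fin (N + 1)))
  · rintro ⟨ht, h, hp⟩
    refine ⟨fun i j hij => ?_, Fin.cases (by simpa using by omega) (by simpa using hp)⟩
    cases j using Fin.cases with
    | zero => exact absurd hij (Fin.not_lt_zero i)
    | succ j =>
      cases i using Fin.cases with
      | zero => simpa using (le_topEntry h j).trans_lt ht
      | succ i => simpa using h (Fin.succ_lt_succ_iff.mp hij)

/-- The term of the series of a multiple zeta value, extended by zero. -/
def chainTerm (k : List ℕ) (m : Fin k.length → ℕ) : ℝ≥0 :=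
  open Classical in
  if StrictAnti m ∧ ∀ i, 0 < m i then ∏ i, ((m i : ℝ≥0)⁻¹) ^ k.get i else 0

theorem chainTerm_of_pos {k : List ℕ} {m : Fin k.length → ℕ} (h : StrictAnti m ∧ ∀ i, 0 < m i) :
    chainTerm k m = ∏ i, ((m i : ℝ≥0)⁻¹) ^ k.get i := if_pos h

theorem chainTerm_of_neg {k : List ℕ} {m : Fin k.length → ℕ}
    (h : ¬(StrictAnti m ∧ ∀ i, 0 < m i)) : chainTerm k m = 0 := if_neg h

theorem chainTerm_cons (a : ℕ) (k : List ℕ) (n : ℕ) (m : Fin k.length → ℕ) :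
    chainTerm (a :: k) (Fin.cons n m : Fin (k.length + 1) → ℕ) =
      if topEntry m < n then ((n : ℝ≥0)⁻¹) ^ a * chainTerm k m else 0 := by
  have key := strictAnti_cons_iff n m
  by_cases h1 : topEntry m < n
  · by_cases h2 : StrictAnti m ∧ ∀ i, 0 < m i
    · rw [if_pos h1, chainTerm_of_pos h2]
      exact (chainTerm_of_pos (k := a :: k) (key.mpr ⟨h1, h2⟩)).trans (Fin.prod_univ_succ _)
    · rw [if_pos h1, chainTerm_of_neg h2, mul_zero]
      exact chainTerm_of_neg (k := a :: k) fun h => h2 (key.mp h).2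
  · rw [if_neg h1]
    exact chainTerm_of_neg (k := a :: k) fun h => h1 (key.mp h).1

/-- This is the same generating series as in `tsum_tower`, so the two forms of a multiple zeta value
agree without an explicit change of variables. -/
theorem tsum_chainTerm (k : List ℕ) (h : ℕ → ℝ≥0∞) :
    ∑' m, (chainTerm k m : ℝ≥0∞) * h (topEntry m) =
      ∑' n, ecoeff n (polylog k) * h n := by
  induction k generalizing h with
  | nil =>
    rw [tsum_eq_single (0 : ℕ) (by intro n hn; simp [PowerSeries.coeff_one, hn]),
      tsum_eq_single default
        (by intro l hl; exact absurd (Subsingleton.elim (α := Fin 0 → ℕ) _ _) hl)]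
    simp [ecoeff, chainTerm, topEntry, Subsingleton.strictAnti]
  | cons a k ih =>
    rw [polylog_cons, tsum_coeff_step, ← ih]
    change ∑' m : Fin (k.length + 1) → ℕ, _ = _
    rw [← (Fin.consEquiv fun _ : Fin (k.length + 1) => ℕ).tsum_eq, ENNReal.tsum_prod',
      ENNReal.tsum_comm]
    refine tsum_congr fun m => ?_
    rw [← ENNReal.tsum_mul_left]
    refine tsum_congr fun n => ?_
    change (chainTerm (a :: k) (Fin.cons n m : Fin (k.length + 1) → ℕ) : ℝ≥0∞) * h n = _
    rw [chainTerm_cons]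
    split_ifs
    · push_cast; ring
    · simp

theorem mzvTerm_eq (k : List ℕ) (m : {m : Fin k.length → ℕ // StrictAnti m ∧ ∀ i, 0 < m i}) :
    mzvTerm k m = chainTerm k m.1 := by
  rw [chainTerm_of_pos m.2, mzvTerm]
  push_cast
  exact Finset.prod_congr rfl fun i _ => by simp

theorem tsum_chainTerm_subtype (k : List ℕ) :
    ∑' m : {m : Fin k.length → ℕ // StrictAnti m ∧ ∀ i, 0 < m i}, (chainTerm k m.1 : ℝ≥0∞) =
      ∑' n, ecoeff n (polylog k) := by
  have := tsum_chainTerm k fun _ => 1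
  simp only [mul_one] at this
  rw [← this]
  refine tsum_subtype_eq_of_support_subset (f := fun m => (chainTerm k m : ℝ≥0∞))
    (s := {m : Fin k.length → ℕ | StrictAnti m ∧ ∀ i, 0 < m i}) fun m hm => ?_
  by_contra hc
  exact hm (by simp only [chainTerm_of_neg hc, ENNReal.coe_zero])

/-! ### Growth of the coefficients -/

theorem coe_coeff_polylog (k : List ℕ) (n : ℕ) :
    ((PowerSeries.coeff n (polylog k : ℝ≥0⟦X⟧) : ℝ≥0) : ℝ) =
      PowerSeries.coeff n (polylog k : ℝ⟦X⟧) := by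
  induction k generalizing n with
  | nil => simp only [polylog_nil, PowerSeries.coeff_one]; split_ifs <;> simp
  | cons a k ih => simp only [polylog_cons, coeff_step]; push_cast; simp only [ih]

theorem coeff_polylog_nonneg (k : List ℕ) (n : ℕ) :
    0 ≤ PowerSeries.coeff n (polylog k : ℝ⟦X⟧) := by
  rw [← coe_coeff_polylog]; exact NNReal.coe_nonneg _

/-- The sum of the first `M` coefficients. -/
def partialSum (M : ℕ) : ℝ⟦X⟧ →ₗ[ℝ] ℝ := ∑ n ∈ Finset.range M, PowerSeries.coeff n

theorem partialSum_apply (M : ℕ) (f : ℝ⟦X⟧) :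
    partialSum M f = ∑ n ∈ Finset.range M, PowerSeries.coeff n f := by
  simp [partialSum]

theorem partialSum_polylog_nonneg (k : List ℕ) (M : ℕ) : 0 ≤ partialSum M (polylog k) := by
  rw [partialSum_apply]
  exact Finset.sum_nonneg fun n _ => coeff_polylog_nonneg k n

theorem coeff_step_real (a n : ℕ) (f : ℝ⟦X⟧) :
    PowerSeries.coeff n (step a f) = ((n : ℝ)⁻¹) ^ a * partialSum n f := by
  rw [coeff_step, partialSum_apply]

theorem sum_range_inv_le (M : ℕ) : ∑ n ∈ Finset.range M, (n : ℝ)⁻¹ ≤ 1 + Real.log M := by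
  rcases M with _ | M
  · simp
  rw [Finset.sum_range_succ']
  have h := harmonic_le_one_add_log M
  have e : ((harmonic M : ℚ) : ℝ) = ∑ n ∈ Finset.range M, ((n + 1 : ℕ) : ℝ)⁻¹ := by
    simp [harmonic]
  rw [e] at h
  have h2 : Real.log (M : ℝ) ≤ Real.log ((M + 1 : ℕ) : ℝ) := by
    rcases Nat.eq_zero_or_pos M with rfl | hM
    · simp
    · exact Real.log_le_log (by exact_mod_cast hM) (by push_cast; linarith)
  simp only [Nat.cast_zero, inv_zero, add_zero]
  linarith

theorem inv_pow_le_inv_pow (n : ℕ) {a b : ℕ} (hab : b ≤ a) (hb : 1 ≤ b) :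
    ((n : ℝ)⁻¹) ^ a ≤ ((n : ℝ)⁻¹) ^ b := by
  rcases Nat.eq_zero_or_pos n with rfl | hn
  -- For `n = 0` both powers are `0`, since the exponents are positive.
  · simp [show a ≠ 0 by omega, show b ≠ 0 by omega]
  · exact pow_le_pow_of_le_one (by positivity) (inv_le_one_of_one_le₀ (by exact_mod_cast hn)) hab

theorem log_natCast_mono {m n : ℕ} (h : m ≤ n) : Real.log m ≤ Real.log n := by
  rcases Nat.eq_zero_or_pos m with rfl | hm
  · simpa using Real.log_natCast_nonneg n
  · exact Real.log_le_log (by exact_mod_cast hm) (by exact_mod_cast h)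

/-- Each summation variable costs at most one harmonic sum, that is, one factor `1 + log M`. -/
theorem partialSum_polylog_le (k : List ℕ) (hk : ∀ i ∈ k, 1 ≤ i) (M : ℕ) :
    partialSum M (polylog k) ≤ (1 + Real.log M) ^ k.length := by
  induction k generalizing M with
  | nil =>
    rw [partialSum_apply]
    simp only [polylog_nil, PowerSeries.coeff_one, List.length_nil, pow_zero]
    rw [Finset.sum_ite_eq']
    split_ifs <;> norm_num
  | cons a k ih =>
    have ih := ih fun i hi => hk i (List.mem_cons_of_mem _ hi)
    have ha := hk a List.mem_cons_self
    have hpos : ∀ n : ℕ, 0 ≤ 1 + Real.log (n : ℝ) := fun n => by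
      have := Real.log_natCast_nonneg n; linarith
    rw [partialSum_apply]
    calc ∑ n ∈ Finset.range M, PowerSeries.coeff n (polylog (a :: k) : ℝ⟦X⟧)
        ≤ ∑ n ∈ Finset.range M, (n : ℝ)⁻¹ * (1 + Real.log M) ^ k.length := by
          refine Finset.sum_le_sum fun n hn => ?_
          rw [polylog_cons, coeff_step_real]
          refine mul_le_mul ?_ ?_ (partialSum_polylog_nonneg _ _) (by positivity)
          · simpa using inv_pow_le_inv_pow n ha le_rfl
          · refine (ih n).trans (pow_le_pow_left₀ (hpos n) ?_ _)
            have := log_natCast_mono (Finset.mem_range.mp hn).le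
            linarith
      _ ≤ (1 + Real.log M) * (1 + Real.log M) ^ k.length := by
          rw [← Finset.sum_mul]
          exact mul_le_mul_of_nonneg_right (sum_range_inv_le M) (pow_nonneg (hpos M) _)
      _ = _ := by rw [List.length_cons, pow_succ']

theorem exists_one_add_log_pow_le (L : ℕ) :
    ∃ C : ℝ, 0 ≤ C ∧ ∀ n : ℕ, 1 ≤ n → (1 + Real.log n) ^ L ≤ C * (n : ℝ) ^ (1 / 4 : ℝ) := by
  -- Chosen so that `ε * L ≤ 1 / 4`, also when `L = 0`.
  set ε : ℝ := 1 / (4 * (L + 1)) with hε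
  have hε0 : 0 < ε := by positivity
  refine ⟨(1 + 1 / ε) ^ L, by positivity, fun n hn => ?_⟩
  have hn' : (1 : ℝ) ≤ n := by exact_mod_cast hn
  have h1 : (1 : ℝ) ≤ (n : ℝ) ^ ε := Real.one_le_rpow hn' hε0.le
  have h2 : 1 + Real.log n ≤ (1 + 1 / ε) * (n : ℝ) ^ ε := by
    have := Real.log_le_rpow_div (by linarith : (0 : ℝ) ≤ n) hε0
    rw [add_mul, one_mul, one_div_mul_eq_div]
    linarith
  have h3 : 0 ≤ 1 + Real.log (n : ℝ) := by
    have := Real.log_natCast_nonneg n; linarith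
  calc (1 + Real.log n) ^ L ≤ ((1 + 1 / ε) * (n : ℝ) ^ ε) ^ L := pow_le_pow_left₀ h3 h2 _
    _ = (1 + 1 / ε) ^ L * (n : ℝ) ^ (ε * L) := by
        rw [mul_pow, ← Real.rpow_natCast ((n : ℝ) ^ ε), ← Real.rpow_mul (by linarith)]
    _ ≤ _ := by
        refine mul_le_mul_of_nonneg_left (Real.rpow_le_rpow_of_exponent_le hn' ?_) (by positivity)
        rw [hε, one_div_mul_eq_div, div_le_div_iff₀ (by positivity) (by norm_num)]
        linarith

theorem exists_partialSum_polylog_le (k : List ℕ) (hk : ∀ i ∈ k, 1 ≤ i) :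
    ∃ C : ℝ, 0 ≤ C ∧ ∀ M : ℕ, partialSum M (polylog k) ≤ C * (M : ℝ) ^ (1 / 4 : ℝ) := by
  obtain ⟨C, hC, h⟩ := exists_one_add_log_pow_le k.length
  refine ⟨C, hC, fun M => ?_⟩
  rcases Nat.eq_zero_or_pos M with rfl | hM
  · simp [partialSum_apply]
  · exact (partialSum_polylog_le k hk M).trans (h M hM)

/-- The `n`-th coefficient is `O(n ^ (-2 + 1/4))`, which leaves room for the weight `n ^ (1/2)`.
This weight later yields both the error `exp (-T / 2)` near `t = 1` and the tail bound `M ^ (-1/2)`.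
-/
theorem summable_coeff_polylog_mul_rpow {k : List ℕ} (hk : Admissible k) :
    Summable fun n => PowerSeries.coeff n (polylog k : ℝ⟦X⟧) * (n : ℝ) ^ (1 / 2 : ℝ) := by
  cases k with
  | nil =>
    refine summable_of_ne_finset_zero (s := {0}) fun n hn => ?_
    simp only [Finset.mem_singleton] at hn
    simp [PowerSeries.coeff_one, hn]
  | cons a k =>
    have ha : 2 ≤ a := hk.2 a rfl
    obtain ⟨C, hC, h⟩ := exists_partialSum_polylog_le k
      fun i hi => hk.1 i (List.mem_cons_of_mem _ hi)
    refine Summable.of_nonneg_of_le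
      (fun n => mul_nonneg (coeff_polylog_nonneg _ n) (by positivity)) (fun n => ?_)
      ((Real.summable_nat_rpow.mpr (by norm_num : (-(5 / 4) : ℝ) < -1)).mul_left C)
    rcases Nat.eq_zero_or_pos n with rfl | hn
    · simp
    have hn' : (0 : ℝ) < n := by exact_mod_cast hn
    rw [polylog_cons, coeff_step_real]
    calc ((n : ℝ)⁻¹) ^ a * partialSum n (polylog k) * (n : ℝ) ^ (1 / 2 : ℝ)
        ≤ ((n : ℝ)⁻¹) ^ 2 * (C * (n : ℝ) ^ (1 / 4 : ℝ)) * (n : ℝ) ^ (1 / 2 : ℝ) := by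
          refine mul_le_mul_of_nonneg_right ?_ (by positivity)
          exact mul_le_mul (inv_pow_le_inv_pow n ha (by norm_num)) (h n)
            (partialSum_polylog_nonneg _ _) (by positivity)
      _ = C * (n : ℝ) ^ (-(5 / 4) : ℝ) := by
          have e : ((n : ℝ)⁻¹) ^ 2 = (n : ℝ) ^ (-2 : ℝ) := by
            rw [Real.rpow_neg hn'.le, inv_pow]; norm_num
          rw [e, show (-(5 / 4) : ℝ) = -2 + 1 / 4 + 1 / 2 by norm_num, Real.rpow_add hn',
            Real.rpow_add hn']
          ring

theorem summable_coeff_polylog {k : List ℕ} (hk : Admissible k) :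
    Summable fun n => PowerSeries.coeff n (polylog k : ℝ⟦X⟧) := by
  -- The weight vanishes at `n = 0`, so that term is set aside.
  rw [← summable_nat_add_iff 1]
  refine Summable.of_nonneg_of_le (fun n => coeff_polylog_nonneg _ _) (fun n => ?_)
    ((summable_nat_add_iff 1).mpr (summable_coeff_polylog_mul_rpow hk))
  refine le_mul_of_one_le_right (coeff_polylog_nonneg _ _) (Real.one_le_rpow ?_ (by norm_num))
  push_cast
  linarith [Nat.cast_nonneg (α := ℝ) n]

/-! ### Sums of all coefficients -/

/-- The sum of all coefficients. -/
def total : ℝ≥0⟦X⟧ →+ ℝ≥0∞ where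
  toFun f := ∑' n, ecoeff n f
  map_zero' := by simp [ecoeff]
  map_add' f g := by simp [ecoeff, ENNReal.tsum_add]

theorem total_apply (f : ℝ≥0⟦X⟧) : total f = ∑' n, ecoeff n f := rfl

theorem total_nsmul (n : ℕ) (f : ℝ≥0⟦X⟧) : total (n • f) = (n : ℝ≥0∞) * total f := by
  rw [map_nsmul, nsmul_eq_mul]

theorem total_polylog_ne_top {k : List ℕ} (hk : Admissible k) : total (polylog k) ≠ ⊤ := by
  rw [total_apply, ENNReal.tsum_coe_ne_top_iff_summable, ← NNReal.summable_coe]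
  simpa only [coe_coeff_polylog] using summable_coeff_polylog hk

/-- The power series whose coefficients are summed in the series of a triple. -/
def tripleSeries (r p q : List ℕ) : ℝ≥0⟦X⟧ := chain r (polylog p * polylog q)

theorem tsum_tripleTerm_eq_total (r p q : List ℕ) :
    ∑' l, (tripleTerm r p q l : ℝ≥0∞) = total (tripleSeries r p q) := by
  have := tsum_tripleTerm r p q fun _ => 1
  simpa only [mul_one, ← total_apply, tripleSeries] using this

/-- Summability is not needed: if the series diverges, both sides are `0` by convention. -/
theorem toReal_tsum_coe {ι : Type*} (f : ι → ℝ≥0) :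
    (∑' i, (f i : ℝ≥0∞)).toReal = ∑' i, (f i : ℝ) :=
  ENNReal.tsum_toReal_eq fun _ => ENNReal.coe_ne_top

theorem zeta_eq_total (r p q : List ℕ) :
    Triple.zeta ⟨r, p, q⟩ = (total (tripleSeries r p q)).toReal := by
  rw [Triple.zeta, rootZeta, ← tsum_tripleTerm_eq_total, toReal_tsum_coe]
  exact tsum_congr fun l => rootTerm_point r p q l

theorem mzv_eq_total (k : List ℕ) : mzv k = (total (polylog k)).toReal := by
  rw [mzv, total_apply, ← tsum_chainTerm_subtype, toReal_tsum_coe]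
  exact tsum_congr fun m => mzvTerm_eq k m

theorem mzv_eq_tsum (k : List ℕ) : mzv k = ∑' n, PowerSeries.coeff n (polylog k : ℝ⟦X⟧) := by
  rw [mzv_eq_total, total_apply, toReal_tsum_coe]
  simp only [coe_coeff_polylog]

theorem total_mul (f g : ℝ≥0⟦X⟧) : total (f * g) = total f * total g := by
  have := tsum_coeff_mul f g fun _ => 1
  simp only [mul_one, ENNReal.tsum_mul_right] at this
  exact this

theorem summable_mzvTerm {k : List ℕ} (hk : Admissible k) : Summable (mzvTerm k) := by
  have h := total_polylog_ne_top hk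
  rw [total_apply, ← tsum_chainTerm_subtype, ENNReal.tsum_coe_ne_top_iff_summable,
    ← NNReal.summable_coe] at h
  exact h.congr fun m => (mzvTerm_eq k m).symm

/-! ### Words and indices -/

/-- The letters of `z_{k₁} ⋯ z_{k_N}`. -/
def lettersOf (k : List ℕ) : List Letter :=
  k.flatMap fun p => List.replicate (p - 1) Letter.x ++ [Letter.y]

theorem lettersOf_cons (p : ℕ) (k : List ℕ) :
    lettersOf (p :: k) = List.replicate (p - 1) Letter.x ++ Letter.y :: lettersOf k := by
  simp [lettersOf]

theorem word_append (v w : List Letter) : word (v ++ w) = word v * word w := by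
  simp [word]

theorem z_eq_word (p : ℕ) : z p = word (List.replicate (p - 1) Letter.x ++ [Letter.y]) := by
  simp [z, word]

theorem z_mul_word (p : ℕ) (w : List Letter) :
    z p * word w = word (List.replicate (p - 1) Letter.x ++ Letter.y :: w) := by
  rw [z_eq_word, ← word_append]; simp

theorem zWord_nil : zWord [] = 1 := by simp [zWord]

theorem zWord_cons (p : ℕ) (k : List ℕ) : zWord (p :: k) = z p * zWord k := by simp [zWord]

theorem zWord_append (k l : List ℕ) : zWord (k ++ l) = zWord k * zWord l := by simp [zWord]

theorem zWord_eq_word (k : List ℕ) : zWord k = word (lettersOf k) := by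
  induction k with
  | nil => simp [zWord, lettersOf, word]
  | cons p k ih => rw [zWord_cons, ih, z_mul_word, lettersOf_cons]

/-- Fails for `p = 0`, because truncated subtraction makes `z 0 = z 1`. -/
theorem gen_x_mul_z {p : ℕ} (hp : 1 ≤ p) : gen Letter.x * z p = z (p + 1) := by
  obtain ⟨p, rfl⟩ := Nat.exists_eq_add_of_le' hp
  simp [z, pow_succ', mul_assoc]

theorem z_one : z 1 = gen Letter.y := by simp [z]

theorem exponentsAux_replicate (n m : ℕ) (w : List Letter) :
    exponentsAux n (List.replicate m Letter.x ++ Letter.y :: w) =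
      (n + m + 1) :: exponents w := by
  induction m generalizing n with
  | zero => simp [exponentsAux, exponents]
  | succ m ih => rw [List.replicate_succ, List.cons_append, exponentsAux, ih]; congr 1; omega

theorem exponents_replicate {p : ℕ} (hp : 1 ≤ p) (w : List Letter) :
    exponents (List.replicate (p - 1) Letter.x ++ Letter.y :: w) = p :: exponents w := by
  rw [exponents, exponentsAux_replicate]; congr 1; omega

theorem exponents_lettersOf {k : List ℕ} (hk : ∀ i ∈ k, 1 ≤ i) : exponents (lettersOf k) = k := by
  induction k with
  | nil => rfl
  | cons p k ih =>
    rw [lettersOf_cons, exponents_replicate (hk p List.mem_cons_self),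
      ih fun i hi => hk i (List.mem_cons_of_mem _ hi)]

/-- Covers words ending in `x` too, so the growth bounds apply to the series of every element of
`𝔥`. -/
theorem exponentsAux_pos (n : ℕ) (w : List Letter) : ∀ i ∈ exponentsAux n w, 1 ≤ i := by
  induction w generalizing n with
  | nil => simp [exponentsAux]
  | cons u w ih =>
    cases u with
    | x => exact ih _
    | y =>
      intro i hi
      rcases List.mem_cons.mp hi with rfl | hi
      · omega
      · exact ih _ i hi

/-- A linear map on `𝔥` given on words by a function of the exponents. -/
def ofExponents {V : Type*} [AddCommMonoid V] [Module ℚ V] (f : List ℕ → V) : H →ₗ[ℚ] V :=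
  wordBasis.constr ℚ fun w => f (exponents w)

theorem ofExponents_word {V : Type*} [AddCommMonoid V] [Module ℚ V] (f : List ℕ → V)
    (w : List Letter) : ofExponents f (word w) = f (exponents w) := by
  rw [← wordBasis_apply, ofExponents, Module.Basis.constr_basis]

theorem ofExponents_zWord {V : Type*} [AddCommMonoid V] [Module ℚ V] (f : List ℕ → V)
    {k : List ℕ} (hk : ∀ i ∈ k, 1 ≤ i) : ofExponents f (zWord k) = f k := by
  rw [zWord_eq_word, ofExponents_word, exponents_lettersOf hk]

theorem ofExponents_comp {V W : Type*} [AddCommMonoid V] [Module ℚ V] [AddCommMonoid W]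
    [Module ℚ W] (g : V →ₗ[ℚ] W) (f : List ℕ → V) (h : H) :
    g (ofExponents f h) = ofExponents (fun k => g (f k)) h := by
  have : g ∘ₗ ofExponents f = ofExponents fun k => g (f k) :=
    wordBasis.ext fun w => by
      rw [LinearMap.comp_apply, wordBasis_apply, ofExponents_word, ofExponents_word]
  exact LinearMap.congr_fun this h

theorem symOf_eq : symOf = ofExponents fun k => sym k [] [] := by
  unfold symOf ofExponents
  rfl

theorem symOf_zWord {k : List ℕ} (hk : ∀ i ∈ k, 1 ≤ i) : symOf (zWord k) = sym k [] [] := by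
  rw [symOf_eq, ofExponents_zWord _ hk]

theorem Z_apply (w : H0) : Z w = ofExponents mzv (w : H) := rfl

/-! ### The shuffle product -/

theorem shuffle_one_left (h : H) : shuffle 1 h = h := by
  have : shuffle 1 = LinearMap.id := wordBasis.ext fun w => by
    rw [wordBasis_apply, ← word_nil, shuffle_word, shuffleWord]; rfl
  rw [this]; rfl

theorem shuffleWord_nil_right (w : List Letter) : shuffleWord w [] = word w := by
  cases w <;> rw [shuffleWord]

theorem shuffle_one_right (h : H) : shuffle h 1 = h := by
  have : shuffle.flip 1 = LinearMap.id := wordBasis.ext fun w => by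
    rw [LinearMap.flip_apply, wordBasis_apply, ← word_nil, shuffle_word, shuffleWord_nil_right]; rfl
  rw [← LinearMap.flip_apply, this]; rfl

theorem shuffle_gen_mul (u v : Letter) (a b : H) :
    shuffle (gen u * a) (gen v * b) =
      gen u * shuffle a (gen v * b) + gen v * shuffle (gen u * a) b := by
  have : shuffle.compl₁₂ (LinearMap.mulLeft ℚ (gen u)) (LinearMap.mulLeft ℚ (gen v)) =
      (shuffle.compl₁₂ LinearMap.id (LinearMap.mulLeft ℚ (gen v))).compr₂
        (LinearMap.mulLeft ℚ (gen u)) +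
      (shuffle.compl₁₂ (LinearMap.mulLeft ℚ (gen u)) LinearMap.id).compr₂
        (LinearMap.mulLeft ℚ (gen v)) := by
    refine LinearMap.ext_basis wordBasis wordBasis fun w₁ w₂ => ?_
    simp only [LinearMap.compl₁₂_apply, LinearMap.add_apply, LinearMap.compr₂_apply,
      LinearMap.mulLeft_apply, LinearMap.id_apply, wordBasis_apply, ← word_cons, shuffle_word]
    rw [shuffleWord]
  exact LinearMap.congr_fun₂ this a b

/-- The partial fraction decomposition for the shuffle product. -/
theorem shuffle_z_mul (a b : H) {α β : ℕ} (hα : 1 ≤ α) (hβ : 1 ≤ β) :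
    shuffle (z α * a) (z β * b) =
      ∑ τ ∈ Finset.range β, (α - 1 + τ).choose τ • (z (α + τ) * shuffle a (z (β - τ) * b)) +
      ∑ τ ∈ Finset.range α, (β - 1 + τ).choose τ • (z (β + τ) * shuffle (z (α - τ) * a) b) := by
  refine eq_sum_choose_of_recursion (AddMonoidHom.mulLeft (gen Letter.x))
    (fun i j => z i * shuffle a (z j * b)) (fun i j => z i * shuffle (z j * a) b)
    (fun i j => shuffle (z i * a) (z j * b)) ?_ ?_ ?_ ?_ ?_ ?_ hα hβ
  · intro i j hi; simp [← gen_x_mul_z hi, mul_assoc]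
  · intro i j hi; simp [← gen_x_mul_z hi, mul_assoc]
  · simp only [z_one, shuffle_gen_mul]
  · intro b hb; simp only [z_one, ← gen_x_mul_z hb, mul_assoc, shuffle_gen_mul]; rfl
  · intro b hb; simp only [z_one, ← gen_x_mul_z hb, mul_assoc, shuffle_gen_mul]; rfl
  · intro i j hi hj
    simp only [← gen_x_mul_z hi, ← gen_x_mul_z hj, mul_assoc, shuffle_gen_mul]; rfl

/-! ### Convergent triples -/

theorem convergent_cons_iff {a : ℕ} {r p q : List ℕ} :
    Triple.Convergent ⟨a :: r, p, q⟩ ↔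
      2 ≤ a ∧ (∀ i ∈ r, 1 ≤ i) ∧ (∀ i ∈ p, 1 ≤ i) ∧ ∀ i ∈ q, 1 ≤ i := by
  simp only [Triple.Convergent, Admissible, List.mem_append, List.mem_cons, or_imp, forall_and,
    forall_eq, reduceCtorEq, if_false, List.head?_cons, Option.mem_some_iff, forall_eq']
  constructor
  · tauto
  · rintro ⟨h1, h2, h3, h4⟩
    have : 1 ≤ a := by omega
    tauto

theorem admissible_cons_iff {a : ℕ} {k : List ℕ} :
    Admissible (a :: k) ↔ 2 ≤ a ∧ ∀ i ∈ k, 1 ≤ i := by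
  simp only [Admissible, List.mem_cons, or_imp, forall_and,
    forall_eq, List.head?_cons, Option.mem_some_iff, forall_eq']
  constructor
  · tauto
  · rintro ⟨h1, h2⟩
    have : 1 ≤ a := by omega
    tauto

theorem convergent_nil_iff {p q : List ℕ} :
    Triple.Convergent ⟨[], p, q⟩ ↔ Admissible p ∧ Admissible q := by
  simp only [Triple.Convergent, if_true, List.nil_append, List.mem_append, or_imp, forall_and,
    Admissible]
  tauto

theorem Triple.Convergent.pos {r p q : List ℕ} (h : Triple.Convergent ⟨r, p, q⟩) :
    (∀ i ∈ r, 1 ≤ i) ∧ (∀ i ∈ p, 1 ≤ i) ∧ ∀ i ∈ q, 1 ≤ i := by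
  have := h.1
  simp only [List.mem_append, or_imp, forall_and] at this
  tauto

/-- Decomposing never leaves the convergent triples: for empty `r` the new leading entry is `α + τ`
with `α ≥ 2`, and otherwise the leading entry of `r` stays. -/
theorem convergent_decompose_left {r p q : List ℕ} {α β τ : ℕ}
    (h : Triple.Convergent ⟨r, α :: p, β :: q⟩) (hτ : τ < β) :
    Triple.Convergent ⟨r ++ [α + τ], p, (β - τ) :: q⟩ := by
  have hp := h.pos
  simp only [List.mem_cons, or_imp, forall_and, forall_eq] at hp
  cases r with
  | nil =>
    have := admissible_cons_iff.mp (convergent_nil_iff.mp h).1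
    rw [List.nil_append, convergent_cons_iff]
    simp only [List.mem_cons, or_imp, forall_and, forall_eq]
    refine ⟨by omega, by simp, hp.2.1.2, by omega, hp.2.2.2⟩
  | cons a r =>
    rw [convergent_cons_iff] at h
    rw [List.cons_append, convergent_cons_iff]
    simp only [List.mem_append, List.mem_cons, List.not_mem_nil, or_false, or_imp, forall_and,
      forall_eq]
    exact ⟨h.1, ⟨h.2.1, by omega⟩, hp.2.1.2, by omega, hp.2.2.2⟩

theorem Triple.Convergent.swap {r p q : List ℕ} (h : Triple.Convergent ⟨r, p, q⟩) :
    Triple.Convergent ⟨r, q, p⟩ := by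
  cases r with
  | nil => rw [convergent_nil_iff] at h ⊢; exact h.symm
  | cons a r => rw [convergent_cons_iff] at h ⊢; tauto

theorem convergent_decompose_right {r p q : List ℕ} {α β τ : ℕ}
    (h : Triple.Convergent ⟨r, α :: p, β :: q⟩) (hτ : τ < α) :
    Triple.Convergent ⟨r ++ [β + τ], (α - τ) :: p, q⟩ :=
  (convergent_decompose_left h.swap hτ).swap

theorem Triple.Convergent.admissible_append {r p : List ℕ} (h : Triple.Convergent ⟨r, p, []⟩) :
    Admissible (r ++ p) := by
  cases r with
  | nil => exact (convergent_nil_iff.mp h).1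
  | cons a r =>
    rw [convergent_cons_iff] at h
    rw [List.cons_append, admissible_cons_iff]
    simp only [List.mem_append, or_imp, forall_and]
    tauto

/-- Induction along partial fraction decompositions. -/
theorem Triple.Convergent.induction {P : List ℕ → List ℕ → List ℕ → Prop}
    (left : ∀ r p, Triple.Convergent ⟨r, p, []⟩ → P r p [])
    (right : ∀ r q, Triple.Convergent ⟨r, [], q⟩ → P r [] q)
    (decompose : ∀ r α p β q, Triple.Convergent ⟨r, α :: p, β :: q⟩ →
      (∀ τ < β, P (r ++ [α + τ]) p ((β - τ) :: q)) →
      (∀ τ < α, P (r ++ [β + τ]) ((α - τ) :: p) q) → P r (α :: p) (β :: q))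
    (r p q : List ℕ) (h : Triple.Convergent ⟨r, p, q⟩) : P r p q := by
  -- One entry of `p` or `q` passes to `r`, so this sum of lengths drops by one.
  induction hn : p.length + q.length using Nat.strong_induction_on generalizing r p q with
  | _ n ih =>
    cases p with
    | nil => exact right r q h
    | cons α p =>
      cases q with
      | nil => exact left r _ h
      | cons β q =>
        simp only [List.length_cons] at hn
        refine decompose r α p β q h (fun τ hτ => ?_) fun τ hτ => ?_
        · exact ih (p.length + q.length + 1) (by omega) _ _ _ (convergent_decompose_left h hτ)
            (by simp; omega)
        · exact ih (p.length + q.length + 1) (by omega) _ _ _ (convergent_decompose_right h hτ)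
            (by simp; omega)

/-! ### Partial fraction relations -/

/-- A prefix `r` is allowed because the induction builds one up. The formal decomposition and
`shuffle_z_mul` have the same coefficients, so the claim passes from the pieces to the whole. -/
theorem sym_sub_symOf_mem {r p q : List ℕ} (h : Triple.Convergent ⟨r, p, q⟩) :
    sym r p q - symOf (zWord r * shuffle (zWord p) (zWord q)) ∈ pfdRelations := by
  refine Triple.Convergent.induction (P := fun r p q =>
    sym r p q - symOf (zWord r * shuffle (zWord p) (zWord q)) ∈ pfdRelations) ?_ ?_ ?_ r p q h
  · intro r p h
    rw [zWord_nil, shuffle_one_right, ← zWord_append, symOf_zWord h.admissible_append.1]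
    exact Submodule.subset_span (PFDRelation.concat_left r p h)
  · intro r q h
    rw [zWord_nil, shuffle_one_left, ← zWord_append, symOf_zWord h.swap.admissible_append.1]
    exact Submodule.subset_span (PFDRelation.concat_right r q h)
  · intro r α p β q h ih₁ ih₂
    have hpos := h.pos
    have hα : 1 ≤ α := hpos.2.1 α List.mem_cons_self
    have hβ : 1 ≤ β := hpos.2.2 β List.mem_cons_self
    have h1 : sym r (α :: p) (β :: q) - pfdStep r α p β q ∈ pfdRelations :=
      Submodule.subset_span (PFDRelation.decompose r α p β q h)
    have h2 : pfdStep r α p β q - symOf (zWord r * shuffle (zWord (α :: p)) (zWord (β :: q))) ∈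
        pfdRelations := by
      rw [zWord_cons α, zWord_cons β, shuffle_z_mul _ _ hα hβ, mul_add, Finset.mul_sum,
        Finset.mul_sum, map_add, map_sum, map_sum, pfdStep, add_sub_add_comm,
        ← Finset.sum_sub_distrib, ← Finset.sum_sub_distrib]
      refine add_mem (sum_mem fun τ hτ => ?_) (sum_mem fun τ hτ => ?_)
      · rw [← Nat.cast_smul_eq_nsmul ℚ, mul_smul_comm, map_smul, ← smul_sub]
        refine Submodule.smul_mem _ _ ?_
        simpa [zWord, mul_assoc] using ih₁ τ (Finset.mem_range.mp hτ)
      · rw [← Nat.cast_smul_eq_nsmul ℚ, mul_smul_comm, map_smul, ← smul_sub]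
        refine Submodule.smul_mem _ _ ?_
        simpa [zWord, mul_assoc] using ih₂ τ (Finset.mem_range.mp hτ)
    simpa using add_mem h1 h2

/-! ### Convergence and values of the formal relations -/

theorem tripleSeries_nil_right (r p : List ℕ) : tripleSeries r p [] = polylog (r ++ p) := by
  rw [tripleSeries, polylog_nil, mul_one, polylog, polylog, chain_append]

theorem tripleSeries_nil_left (r q : List ℕ) : tripleSeries r [] q = polylog (r ++ q) := by
  rw [tripleSeries, polylog_nil, one_mul, polylog, polylog, chain_append]

theorem tripleSeries_decompose (r : List ℕ) {α : ℕ} (p : List ℕ) {β : ℕ} (q : List ℕ)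
    (hα : 1 ≤ α) (hβ : 1 ≤ β) :
    tripleSeries r (α :: p) (β :: q) =
      ∑ τ ∈ Finset.range β, (α - 1 + τ).choose τ • tripleSeries (r ++ [α + τ]) p ((β - τ) :: q) +
      ∑ τ ∈ Finset.range α,
        (β - 1 + τ).choose τ • tripleSeries (r ++ [β + τ]) ((α - τ) :: p) q := by
  simp only [tripleSeries, polylog_cons]
  rw [step_mul_step _ _ hα hβ, map_add, map_sum, map_sum]
  simp only [map_nsmul, chain_append, chain_cons, chain_nil]

/-- Repeated decomposition writes the series as a finite combination of polylogarithms of admissible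
indices. -/
theorem total_tripleSeries_ne_top {r p q : List ℕ} (h : Triple.Convergent ⟨r, p, q⟩) :
    total (tripleSeries r p q) ≠ ⊤ := by
  refine Triple.Convergent.induction (P := fun r p q =>
    total (tripleSeries r p q) ≠ ⊤) ?_ ?_ ?_ r p q h
  · intro r p h
    rw [tripleSeries_nil_right]; exact total_polylog_ne_top h.admissible_append
  · intro r q h
    rw [tripleSeries_nil_left]; exact total_polylog_ne_top h.swap.admissible_append
  · intro r α p β q h ih₁ ih₂
    have hpos := h.pos
    rw [tripleSeries_decompose r p q (hpos.2.1 α List.mem_cons_self)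
      (hpos.2.2 β List.mem_cons_self), map_add, map_sum, map_sum]
    simp only [total_nsmul]
    refine ENNReal.add_ne_top.mpr ⟨ENNReal.sum_ne_top.mpr fun τ hτ => ?_,
      ENNReal.sum_ne_top.mpr fun τ hτ => ?_⟩
    · exact ENNReal.mul_ne_top (ENNReal.natCast_ne_top _) (ih₁ τ (Finset.mem_range.mp hτ))
    · exact ENNReal.mul_ne_top (ENNReal.natCast_ne_top _) (ih₂ τ (Finset.mem_range.mp hτ))

theorem summable_rootTerm {t : Triple} (h : t.Convergent) : Summable (rootTerm t.point) := by
  obtain ⟨r, p, q⟩ := t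
  have h := total_tripleSeries_ne_top h
  rw [← tsum_tripleTerm_eq_total, ENNReal.tsum_coe_ne_top_iff_summable,
    ← NNReal.summable_coe] at h
  exact h.congr fun l => (rootTerm_point r p q l).symm

theorem zeta_decompose {r p q : List ℕ} {α β : ℕ} (h : Triple.Convergent ⟨r, α :: p, β :: q⟩) :
    Triple.zeta ⟨r, α :: p, β :: q⟩ =
      ∑ τ ∈ Finset.range β,
        ((α - 1 + τ).choose τ : ℝ) * Triple.zeta ⟨r ++ [α + τ], p, (β - τ) :: q⟩ +
      ∑ τ ∈ Finset.range α,
        ((β - 1 + τ).choose τ : ℝ) * Triple.zeta ⟨r ++ [β + τ], (α - τ) :: p, q⟩ := by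
  have hpos := h.pos
  have n1 : ∀ τ ∈ Finset.range β, (((α - 1 + τ).choose τ : ℝ≥0∞) *
      total (tripleSeries (r ++ [α + τ]) p ((β - τ) :: q))) ≠ ⊤ := fun τ hτ =>
    ENNReal.mul_ne_top (ENNReal.natCast_ne_top _)
      (total_tripleSeries_ne_top (convergent_decompose_left h (Finset.mem_range.mp hτ)))
  have n2 : ∀ τ ∈ Finset.range α, (((β - 1 + τ).choose τ : ℝ≥0∞) *
      total (tripleSeries (r ++ [β + τ]) ((α - τ) :: p) q)) ≠ ⊤ := fun τ hτ =>
    ENNReal.mul_ne_top (ENNReal.natCast_ne_top _)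
      (total_tripleSeries_ne_top (convergent_decompose_right h (Finset.mem_range.mp hτ)))
  simp only [zeta_eq_total]
  rw [tripleSeries_decompose r p q (hpos.2.1 α List.mem_cons_self)
      (hpos.2.2 β List.mem_cons_self), map_add, map_sum, map_sum]
  simp only [total_nsmul]
  rw [ENNReal.toReal_add (ENNReal.sum_ne_top.mpr n1) (ENNReal.sum_ne_top.mpr n2),
    ENNReal.toReal_sum n1, ENNReal.toReal_sum n2]
  simp only [ENNReal.toReal_mul, ENNReal.toReal_natCast]

theorem symEval_sym (r p q : List ℕ) : symEval (sym r p q) = Triple.zeta ⟨r, p, q⟩ := by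
  simp [symEval, sym]

theorem symEval_eq_zero {e : Triple →₀ ℚ} (he : e ∈ pfdRelations) : symEval e = 0 := by
  suffices pfdRelations ≤ LinearMap.ker symEval from this he
  refine Submodule.span_le.mpr fun e he => ?_
  rw [SetLike.mem_coe, LinearMap.mem_ker]
  cases he with
  | decompose r α p β q h =>
    rw [map_sub, symEval_sym, pfdStep, map_add, map_sum, map_sum, zeta_decompose h]
    simp only [map_smul, symEval_sym]
    simp [Algebra.smul_def]
  | concat_left r p h =>
    rw [map_sub, symEval_sym, symEval_sym, zeta_eq_total, zeta_eq_total,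
      tripleSeries_nil_right, tripleSeries_nil_right, List.append_nil, sub_self]
  | concat_right r q h =>
    rw [map_sub, symEval_sym, symEval_sym, zeta_eq_total, zeta_eq_total,
      tripleSeries_nil_left, tripleSeries_nil_left, List.append_nil, sub_self]

theorem zeta_eq_mzv (k : List ℕ) : Triple.zeta ⟨k, [], []⟩ = mzv k := by
  rw [zeta_eq_total, tripleSeries_nil_left, List.append_nil, mzv_eq_total]

theorem zeta_eq_mzv_mul_mzv (p q : List ℕ) : Triple.zeta ⟨[], p, q⟩ = mzv p * mzv q := by
  rw [zeta_eq_total, tripleSeries, chain_nil, total_mul, ENNReal.toReal_mul, mzv_eq_total, mzv_eq_total]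

theorem symEval_symOf (h : H) : symEval (symOf h) = ofExponents mzv h := by
  rw [symOf_eq, ofExponents_comp]
  simp only [symEval_sym, zeta_eq_mzv]

theorem ofExponents_mzv_shuffle_zWord {p q : List ℕ} (hp : Admissible p) (hq : Admissible q) :
    ofExponents mzv (shuffle (zWord p) (zWord q)) = Triple.zeta ⟨[], p, q⟩ := by
  have := symEval_eq_zero (sym_sub_symOf_mem (convergent_nil_iff.mpr ⟨hp, hq⟩))
  rw [zWord_nil, one_mul, map_sub, symEval_sym, symEval_symOf, sub_eq_zero] at this
  exact this.symm

/-! ### Index words spanning `𝔥¹` and `𝔥⁰`, and multiplicativity of `Z` -/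

theorem IsH1Word.exists_lettersOf {w : List Letter} (hw : IsH1Word w) :
    ∃ k : List ℕ, (∀ i ∈ k, 1 ≤ i) ∧ w = lettersOf k := by
  rcases hw with rfl | ⟨v, rfl⟩
  · exact ⟨[], by simp, rfl⟩
  · induction v with
    | nil => exact ⟨[1], by simp, rfl⟩
    | cons u v ih =>
      obtain ⟨k, hk, e⟩ := ih
      rw [List.cons_append, e]
      cases u with
      | y => exact ⟨1 :: k, by simpa using hk, by simp [lettersOf_cons]⟩
      | x =>
        cases k with
        | nil => exact absurd e (by simp [lettersOf])
        | cons a k =>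
          have ha : 1 ≤ a := hk a List.mem_cons_self
          obtain ⟨a, rfl⟩ := Nat.exists_eq_add_of_le' ha
          refine ⟨(a + 2) :: k, fun i hi => ?_, by simp [lettersOf_cons, List.replicate_succ]⟩
          rcases List.mem_cons.mp hi with rfl | hi
          · omega
          · exact hk i (List.mem_cons_of_mem _ hi)

theorem IsH0Word.exists_lettersOf {w : List Letter} (hw : IsH0Word w) :
    ∃ k : List ℕ, Admissible k ∧ w = lettersOf k := by
  rcases hw with rfl | ⟨v, rfl⟩
  · exact ⟨[], by simp [Admissible], rfl⟩
  · obtain ⟨k, hk, e⟩ := IsH1Word.exists_lettersOf (w := Letter.x :: (v ++ [Letter.y]))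
      (Or.inr ⟨Letter.x :: v, rfl⟩)
    refine ⟨k, ?_, e⟩
    cases k with
    | nil => simp [lettersOf] at e
    | cons a k =>
      rw [admissible_cons_iff]
      refine ⟨?_, fun i hi => hk i (List.mem_cons_of_mem _ hi)⟩
      by_contra hc
      have : a - 1 = 0 := by omega
      simp [lettersOf_cons, this] at e

theorem H1_le_span_zWord : H1 ≤ Submodule.span ℚ (zWord '' {k | ∀ i ∈ k, 1 ≤ i}) := by
  refine H1_le_span.trans (Submodule.span_mono ?_)
  rintro _ ⟨w, hw, rfl⟩
  obtain ⟨k, hk, rfl⟩ := IsH1Word.exists_lettersOf hw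
  exact ⟨k, hk, zWord_eq_word k⟩

theorem H0_le_span_zWord : H0 ≤ Submodule.span ℚ (zWord '' {k | Admissible k}) := by
  refine H0_le_span.trans (Submodule.span_mono ?_)
  rintro _ ⟨w, hw, rfl⟩
  obtain ⟨k, hk, rfl⟩ := IsH0Word.exists_lettersOf hw
  exact ⟨k, hk, zWord_eq_word k⟩

theorem Z_shuffle0 (w₁ w₂ : H0) : Z (shuffle0 w₁ w₂) = Z w₁ * Z w₂ := by
  obtain ⟨w₁, h₁⟩ := w₁
  obtain ⟨w₂, h₂⟩ := w₂
  simp only [Z_apply, shuffle0]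
  replace h₁ := H0_le_span_zWord h₁
  replace h₂ := H0_le_span_zWord h₂
  induction h₁ using Submodule.span_induction with
  | zero => simp
  | add a b _ _ ha hb => simp only [map_add, LinearMap.add_apply, add_mul, ha, hb]
  | smul c a _ ha => simp only [map_smul, LinearMap.smul_apply, ha, smul_mul_assoc]
  | mem _ h =>
    obtain ⟨p, hp, rfl⟩ := h
    induction h₂ using Submodule.span_induction with
    | zero => simp
    | add a b _ _ ha hb => simp only [map_add, mul_add, ha, hb]
    | smul c a _ ha => simp only [map_smul, ha, mul_smul_comm]
    | mem _ h =>
      obtain ⟨q, hq, rfl⟩ := h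
      rw [ofExponents_mzv_shuffle_zWord hp hq, zeta_eq_mzv_mul_mzv, ofExponents_zWord _ hp.1,
        ofExponents_zWord _ hq.1]

/-! ### Products of multiple polylogarithms -/

/-- The power series of an element of `𝔥`. -/
def series : H →ₗ[ℚ] ℝ⟦X⟧ := ofExponents polylog

theorem series_zWord {k : List ℕ} (hk : ∀ i ∈ k, 1 ≤ i) : series (zWord k) = polylog k :=
  ofExponents_zWord _ hk

theorem series_z_mul {p : ℕ} (hp : 1 ≤ p) (h : H) : series (z p * h) = step p (series h) := by
  have : series ∘ₗ LinearMap.mulLeft ℚ (z p) = (step p).restrictScalars ℚ ∘ₗ series :=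
    wordBasis.ext fun w => by
      simp only [LinearMap.comp_apply, LinearMap.mulLeft_apply, wordBasis_apply, z_mul_word,
        LinearMap.restrictScalars_apply]
      rw [series, ofExponents_word, ofExponents_word, exponents_replicate hp, polylog_cons]
  exact LinearMap.congr_fun this h

/-- Products of polylogarithms and shuffles of words obey the same partial fraction decomposition,
which lowers the total length by one under a leading `z` or `step`. -/
theorem series_shuffle_zWord {k l : List ℕ} (hk : ∀ i ∈ k, 1 ≤ i) (hl : ∀ i ∈ l, 1 ≤ i) :
    series (shuffle (zWord k) (zWord l)) = polylog k * polylog l := by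
  induction hn : k.length + l.length using Nat.strong_induction_on generalizing k l with
  | _ n ih =>
    cases k with
    | nil => rw [zWord_nil, shuffle_one_left, series_zWord hl, polylog_nil, one_mul]
    | cons α k =>
      cases l with
      | nil => rw [zWord_nil, shuffle_one_right, series_zWord hk, polylog_nil, mul_one]
      | cons β l =>
        simp only [List.length_cons] at hn
        simp only [List.mem_cons, or_imp, forall_and, forall_eq] at hk hl
        rw [zWord_cons, zWord_cons, shuffle_z_mul _ _ hk.1 hl.1, polylog_cons, polylog_cons,
          step_mul_step _ _ hk.1 hl.1, map_add, map_sum, map_sum]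
        congr 1
        · refine Finset.sum_congr rfl fun τ hτ => ?_
          have hτ := Finset.mem_range.mp hτ
          have := ih (k.length + l.length + 1) (by omega) (k := k) (l := (β - τ) :: l) hk.2
            (by simp only [List.mem_cons, or_imp, forall_and, forall_eq]
                exact ⟨by omega, hl.2⟩) (by simp; omega)
          rw [zWord_cons, polylog_cons] at this
          rw [map_nsmul, series_z_mul (by omega), this]
        · refine Finset.sum_congr rfl fun τ hτ => ?_
          have hτ := Finset.mem_range.mp hτ
          have := ih (k.length + l.length + 1) (by omega) (k := (α - τ) :: k) (l := l)
            (by simp only [List.mem_cons, or_imp, forall_and, forall_eq]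
                exact ⟨by omega, hk.2⟩) hl.2 (by simp; omega)
          rw [zWord_cons, polylog_cons] at this
          rw [map_nsmul, series_z_mul (by omega), this]

/-! ### Truncated sums and the harmonic product -/

theorem partialSum_succ_step (M a : ℕ) (f : ℝ⟦X⟧) :
    partialSum (M + 1) (step a f) =
      partialSum M (step a f) + ((M : ℝ)⁻¹) ^ a * partialSum M f := by
  rw [partialSum_apply, Finset.sum_range_succ, coeff_step_real, ← partialSum_apply]

/-- Passing from `M` to `M + 1` replaces the product `P * Q` by `(P + u * A) * (Q + v * B)`. The
three new terms `u * A * Q`, `v * P * B` and `u * v * A * B` are those of the harmonic recursion. -/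
theorem partialSum_harmonicWord {k l : List ℕ} (hk : ∀ i ∈ k, 1 ≤ i) (hl : ∀ i ∈ l, 1 ≤ i)
    (M : ℕ) :
    partialSum M (series (harmonicWord k l)) =
      partialSum M (polylog k) * partialSum M (polylog l) := by
  have one : ∀ M, partialSum M (1 : ℝ⟦X⟧) = if M = 0 then 0 else 1 := fun M => by
    simp [partialSum_apply, PowerSeries.coeff_one, Nat.pos_iff_ne_zero]
  have zero : ∀ f : ℝ⟦X⟧, partialSum 0 f = 0 := fun f => by simp [partialSum_apply]
  induction hn : k.length + l.length using Nat.strong_induction_on generalizing k l M with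
  | _ n ih =>
    cases k with
    | nil =>
      rw [harmonicWord, series_zWord hl, polylog_nil, one]
      split_ifs with h
      · rw [h, zero, zero_mul]
      · rw [one_mul]
    | cons p k =>
      cases l with
      | nil =>
        rw [harmonicWord, series_zWord hk, polylog_nil, one]
        split_ifs with h
        · rw [h, zero, zero_mul]
        · rw [mul_one]
      | cons q l =>
        simp only [List.length_cons] at hn
        have hk' := hk
        have hl' := hl
        simp only [List.mem_cons, or_imp, forall_and, forall_eq] at hk hl
        rw [harmonicWord]
        simp only [map_add, polylog_cons]
        rw [series_z_mul hk.1, series_z_mul hl.1, series_z_mul (by omega)]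
        induction M with
        | zero => simp [zero]
        | succ M ihM =>
          simp only [partialSum_succ_step]
          rw [ih (k.length + (l.length + 1)) (by omega) hk.2 hl' M (by simp),
            ih (k.length + 1 + l.length) (by omega) hk' hl.2 M (by simp),
            ih (k.length + l.length) (by omega) hk.2 hl.2 M rfl, polylog_cons, polylog_cons,
            pow_add]
          linear_combination ihM

/-- Bilinear identities on `𝔥¹` may be checked on words. -/
theorem H1_bilin_ext {V : Type*} [AddCommGroup V] [Module ℚ V] (f g : H →ₗ[ℚ] H →ₗ[ℚ] V)
    (h : ∀ k l : List ℕ, (∀ i ∈ k, 1 ≤ i) → (∀ i ∈ l, 1 ≤ i) →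
      f (zWord k) (zWord l) = g (zWord k) (zWord l)) {a b : H} (ha : a ∈ H1) (hb : b ∈ H1) :
    f a b = g a b := by
  replace ha := H1_le_span_zWord ha
  replace hb := H1_le_span_zWord hb
  induction ha using Submodule.span_induction with
  | zero => simp
  | add a a' _ _ h h' => simp only [map_add, LinearMap.add_apply, h, h']
  | smul c a _ h => simp only [map_smul, LinearMap.smul_apply, h]
  | mem _ hk =>
    obtain ⟨k, hk, rfl⟩ := hk
    induction hb using Submodule.span_induction with
    | zero => simp
    | add a a' _ _ h h' => simp only [map_add, h, h']
    | smul c a _ h => simp only [map_smul, h]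
    | mem _ hl =>
      obtain ⟨l, hl, rfl⟩ := hl
      exact h k l hk hl

theorem series_shuffle {a b : H} (ha : a ∈ H1) (hb : b ∈ H1) :
    series (shuffle a b) = series a * series b := by
  have := H1_bilin_ext (shuffle.compr₂ series)
    ((LinearMap.mul ℚ ℝ⟦X⟧).compl₁₂ series series) (fun k l hk hl => ?_) ha hb
  · simpa only [LinearMap.compr₂_apply, LinearMap.compl₁₂_apply, LinearMap.mul_apply'] using this
  simp only [LinearMap.compr₂_apply, LinearMap.compl₁₂_apply, LinearMap.mul_apply',
    series_zWord hk, series_zWord hl, series_shuffle_zWord hk hl]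

theorem harmonicAux_zWord {k l : List ℕ} (hk : ∀ i ∈ k, 1 ≤ i) (hl : ∀ i ∈ l, 1 ≤ i) :
    harmonicAux (zWord k) (zWord l) = harmonicWord k l := by
  rw [zWord_eq_word, zWord_eq_word, ← wordBasis_apply, ← wordBasis_apply, harmonicAux,
    Module.Basis.constr_basis, Module.Basis.constr_basis, exponents_lettersOf hk,
    exponents_lettersOf hl]

/-- The sum of the first `M` coefficients, on `𝔥`. -/
def truncation (M : ℕ) : H →ₗ[ℚ] ℝ := (partialSum M).restrictScalars ℚ ∘ₗ series

theorem truncation_apply (M : ℕ) (h : H) : truncation M h = partialSum M (series h) := rfl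

theorem truncation_harmonic (M : ℕ) {a b : H} (ha : a ∈ H1) (hb : b ∈ H1) :
    truncation M (harmonicAux a b) = truncation M a * truncation M b := by
  have := H1_bilin_ext (harmonicAux.compr₂ (truncation M))
    ((LinearMap.mul ℚ ℝ).compl₁₂ (truncation M) (truncation M)) (fun k l hk hl => ?_) ha hb
  · simpa only [LinearMap.compr₂_apply, LinearMap.compl₁₂_apply, LinearMap.mul_apply'] using this
  simp only [LinearMap.compr₂_apply, LinearMap.compl₁₂_apply, LinearMap.mul_apply',
    truncation_apply, harmonicAux_zWord hk hl, partialSum_harmonicWord hk hl, series_zWord hk,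
    series_zWord hl]

/-! ### Generation of `𝔥¹` -/

theorem isH1Word_lettersOf (k : List ℕ) : IsH1Word (lettersOf k) := by
  induction k with
  | nil => exact Or.inl rfl
  | cons a k ih =>
    rw [lettersOf_cons]
    rcases ih with h | ⟨v, h⟩
    · exact Or.inr ⟨List.replicate (a - 1) Letter.x, by rw [h]⟩
    · exact Or.inr ⟨List.replicate (a - 1) Letter.x ++ Letter.y :: v, by rw [h]; simp⟩

theorem zWord_mem_H0 {k : List ℕ} (hk : Admissible k) : zWord k ∈ H0 := by
  cases k with
  | nil => rw [zWord_nil]; exact one_mem_H0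
  | cons a k =>
    obtain ⟨a, rfl⟩ := Nat.exists_eq_add_of_le' (admissible_cons_iff.mp hk).1
    have e : lettersOf ((a + 2) :: k) = Letter.x :: lettersOf ((a + 1) :: k) := by
      simp [lettersOf_cons, List.replicate_succ]
    rw [zWord_eq_word, e, word_cons]
    rcases isH1Word_lettersOf ((a + 1) :: k) with h | ⟨v, h⟩
    · simp [lettersOf_cons] at h
    · rw [h, word_append_y]
      exact gen_mul_mul_gen_mem_H0 _

/-- The leading entries `1` are split off as a power of `y`. -/
theorem exists_zWord_eq_pow_mul {k : List ℕ} (hk : ∀ i ∈ k, 1 ≤ i) :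
    ∃ n : ℕ, ∃ h ∈ H0, zWord k = gen Letter.y ^ n * h := by
  induction k with
  | nil => exact ⟨0, 1, one_mem_H0, by simp [zWord_nil]⟩
  | cons a k ih =>
    simp only [List.mem_cons, or_imp, forall_and, forall_eq] at hk
    rcases hk.1.eq_or_lt with rfl | ha
    · obtain ⟨n, h, hh, e⟩ := ih hk.2
      exact ⟨n + 1, h, hh, by rw [zWord_cons, z_one, e, pow_succ', mul_assoc]⟩
    · exact ⟨0, _, zWord_mem_H0 (admissible_cons_iff.mpr ⟨ha, hk.2⟩), by simp⟩

theorem shuffle_y_pow_mul (n : ℕ) (h : H) :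
    shuffle (gen Letter.y) (gen Letter.y ^ n * h) =
      n • (gen Letter.y ^ (n + 1) * h) + gen Letter.y ^ n * shuffle (gen Letter.y) h := by
  induction n with
  | zero => simp
  | succ n ih =>
    have := shuffle_gen_mul Letter.y Letter.y 1 (gen Letter.y ^ n * h)
    rw [mul_one, shuffle_one_left, ih] at this
    rw [pow_succ', mul_assoc, this]
    simp only [mul_add, mul_smul_comm, pow_succ', mul_assoc, add_smul, one_smul]
    abel

theorem shuffle_y_mul_y (a : H) : ∃ b, shuffle (gen Letter.y) (a * gen Letter.y) =
    b * gen Letter.y := by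
  induction mem_span_words a using Submodule.span_induction with
  | zero => exact ⟨0, by simp⟩
  | add a a' _ _ h h' =>
    obtain ⟨b, hb⟩ := h
    obtain ⟨b', hb'⟩ := h'
    exact ⟨b + b', by rw [add_mul, map_add, hb, hb', add_mul]⟩
  | smul c a _ h =>
    obtain ⟨b, hb⟩ := h
    exact ⟨c • b, by rw [smul_mul_assoc, map_smul, hb, smul_mul_assoc]⟩
  | mem _ h =>
    obtain ⟨v, rfl⟩ := h
    have := shuffleWord_mem_range [Letter.y] (v ++ [Letter.y]) (Or.inr ⟨[], rfl⟩)
      (Or.inr ⟨v, rfl⟩) (by simp)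
    rw [← shuffle_word, word_append_y] at this
    simpa [word] using this

/-- Shuffling `y` into `x c y` either puts `y` in front, which is subtracted, or keeps `x` in front
and leaves a word ending in `y`. -/
theorem shuffle_y_sub_mem_H0 {h : H} (hh : h ∈ H0) :
    shuffle (gen Letter.y) h - gen Letter.y * h ∈ H0 := by
  obtain ⟨a, ha, b, ⟨c, rfl⟩, rfl⟩ := Submodule.mem_sup.mp hh
  obtain ⟨q, rfl⟩ := Submodule.mem_one.mp ha
  obtain ⟨d, hd⟩ := shuffle_y_mul_y c
  have h1 := shuffle_gen_mul Letter.y Letter.x 1 (c * gen Letter.y)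
  rw [mul_one, shuffle_one_left, hd] at h1
  simp only [LinearMap.comp_apply, LinearMap.mulLeft_apply, LinearMap.mulRight_apply, map_add, h1,
    Algebra.algebraMap_eq_smul_one, map_smul, shuffle_one_right, mul_add, mul_smul_comm, mul_one]
  convert gen_mul_mul_gen_mem_H0 d using 1
  abel

/-- `𝔥¹` is generated by `y` as an algebra over `𝔥⁰`, for the shuffle product. -/
theorem H1_le_of_shuffle_closed (K : Submodule ℚ H) (h0 : H0 ≤ K)
    (hy : ∀ h ∈ K, shuffle (gen Letter.y) h ∈ K) : H1 ≤ K := by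
  have key : ∀ n : ℕ, ∀ h ∈ H0, gen Letter.y ^ n * h ∈ K := by
    intro n
    induction n with
    | zero => intro h hh; simpa using h0 hh
    | succ n ih =>
      intro h hh
      -- The difference is `(n + 1) y ^ (n + 1) h`, and `n + 1` is invertible in `ℚ`.
      have h1 := sub_mem (hy _ (ih h hh)) (ih _ (shuffle_y_sub_mem_H0 hh))
      have h2 : shuffle (gen Letter.y) (gen Letter.y ^ n * h) -
          gen Letter.y ^ n * (shuffle (gen Letter.y) h - gen Letter.y * h) =
          ((n + 1 : ℕ) : ℚ) • (gen Letter.y ^ (n + 1) * h) := by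
        rw [shuffle_y_pow_mul, Nat.cast_smul_eq_nsmul, mul_sub, ← mul_assoc, ← pow_succ, add_smul,
          one_smul]
        abel
      rw [h2] at h1
      exact (Submodule.smul_mem_iff _ (by positivity)).mp h1
  refine H1_le_span_zWord.trans (Submodule.span_le.mpr ?_)
  rintro _ ⟨k, hk, rfl⟩
  obtain ⟨n, h, hh, e⟩ := exists_zWord_eq_pow_mul hk
  rw [e]
  exact key n h hh

/-! ### Values of the power series -/

/-- The value of a power series at `t`. -/
def evalAt (t : ℝ) (f : ℝ⟦X⟧) : ℝ := ∑' n, PowerSeries.coeff n f * t ^ n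

theorem coeff_polylog_le {k : List ℕ} (hk : ∀ i ∈ k, 1 ≤ i) :
    ∃ C : ℝ, ∀ n, PowerSeries.coeff n (polylog k : ℝ⟦X⟧) ≤ C * (n + 1) := by
  obtain ⟨C, hC, h⟩ := exists_partialSum_polylog_le k hk
  refine ⟨C, fun n => ?_⟩
  have h1 : PowerSeries.coeff n (polylog k : ℝ⟦X⟧) ≤ partialSum (n + 1) (polylog k) := by
    rw [partialSum_apply]
    exact Finset.single_le_sum (f := fun n => PowerSeries.coeff n (polylog k : ℝ⟦X⟧))
      (fun i _ => coeff_polylog_nonneg k i) (Finset.self_mem_range_succ n)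
  refine (h1.trans (h (n + 1))).trans (mul_le_mul_of_nonneg_left ?_ hC)
  push_cast
  calc ((n : ℝ) + 1) ^ (1 / 4 : ℝ) ≤ ((n : ℝ) + 1) ^ (1 : ℝ) :=
        Real.rpow_le_rpow_of_exponent_le (by linarith [Nat.cast_nonneg (α := ℝ) n]) (by norm_num)
    _ = _ := Real.rpow_one _

theorem summable_series (h : H) {t : ℝ} (ht : |t| < 1) :
    Summable fun n => PowerSeries.coeff n (series h) * t ^ n := by
  induction mem_span_words h using Submodule.span_induction with
  | zero => simp
  | add a b _ _ ha hb => simpa [add_mul] using ha.add hb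
  | smul c a _ ha =>
    rw [map_smul]
    refine (ha.mul_left (c : ℝ)).congr fun n => ?_
    rw [← mul_assoc]
    congr 1
  | mem _ h =>
    obtain ⟨w, rfl⟩ := h
    rw [series, ofExponents_word]
    obtain ⟨C, hC⟩ := coeff_polylog_le (exponentsAux_pos 0 w)
    have ht' : ‖|t|‖ < 1 := by simpa using ht
    have s1 := summable_pow_mul_geometric_of_norm_lt_one 1 ht'
    have s0 := summable_geometric_of_norm_lt_one ht'
    refine Summable.of_norm_bounded ((s1.add s0).mul_left C) fun n => ?_
    rw [norm_mul, norm_pow, Real.norm_eq_abs, Real.norm_eq_abs,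
      abs_of_nonneg (coeff_polylog_nonneg _ _)]
    calc _ ≤ C * (n + 1) * |t| ^ n := mul_le_mul_of_nonneg_right (hC n) (by positivity)
      _ = _ := by ring

theorem evalAt_add {t : ℝ} (ht : |t| < 1) (a b : H) :
    evalAt t (series (a + b)) = evalAt t (series a) + evalAt t (series b) := by
  rw [evalAt, evalAt, evalAt, ← (summable_series a ht).tsum_add (summable_series b ht)]
  simp [add_mul]

theorem evalAt_smul (t : ℝ) (c : ℚ) (a : H) :
    evalAt t (series (c • a)) = c • evalAt t (series a) := by
  rw [evalAt, evalAt, map_smul, ← Rat.cast_smul_eq_qsmul ℝ, ← Rat.cast_smul_eq_qsmul ℝ,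
    smul_eq_mul, ← tsum_mul_left]
  simp [mul_assoc]

theorem evalAt_shuffle {t : ℝ} (ht : |t| < 1) {a b : H} (ha : a ∈ H1) (hb : b ∈ H1) :
    evalAt t (series (shuffle a b)) = evalAt t (series a) * evalAt t (series b) := by
  rw [evalAt, evalAt, evalAt, series_shuffle ha hb,
    tsum_mul_tsum_eq_tsum_sum_antidiagonal_of_summable_norm (summable_series a ht).norm
      (summable_series b ht).norm]
  refine tsum_congr fun n => ?_
  rw [PowerSeries.coeff_mul, Finset.sum_mul]
  refine Finset.sum_congr rfl fun ij hij => ?_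
  rw [← Finset.HasAntidiagonal.mem_antidiagonal.mp hij, pow_add]
  ring

theorem evalAt_y {t : ℝ} (ht : |t| < 1) : evalAt t (series (gen Letter.y)) = -Real.log (1 - t) := by
  have e : series (gen Letter.y) = polylog [1] := by
    rw [← z_one, ← mul_one (z 1), ← zWord_nil, ← zWord_cons, series_zWord (by simp)]
  have h := Real.hasSum_pow_div_log_of_abs_lt_one ht
  have c : ∀ n, PowerSeries.coeff n (polylog [1] : ℝ⟦X⟧) = (n : ℝ)⁻¹ := fun n => by
    rw [polylog_cons, coeff_step, polylog_nil, pow_one]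
    rcases Nat.eq_zero_or_pos n with rfl | hn
    · simp
    · simp [PowerSeries.coeff_one, hn.ne']
  rw [evalAt, ← h.tsum_eq, (summable_series _ ht).tsum_eq_zero_add, e]
  simp only [c]
  simp [div_eq_inv_mul]

/-! ### Asymptotic expansions -/

/-- Functions that decay at infinity faster than every power. -/
def Negligible (e : ℝ → ℝ) : Prop := ∀ i : ℕ, Tendsto (fun T => e T * T ^ i) atTop (𝓝 0)

theorem Negligible.tendsto {e : ℝ → ℝ} (h : Negligible e) : Tendsto e atTop (𝓝 0) := by
  simpa using h 0

theorem Negligible.add {e e' : ℝ → ℝ} (h : Negligible e) (h' : Negligible e') :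
    Negligible fun T => e T + e' T := fun i => by
  simpa [add_mul] using (h i).add (h' i)

theorem Negligible.const_mul {e : ℝ → ℝ} (c : ℝ) (h : Negligible e) :
    Negligible fun T => c * e T := fun i => by
  simpa [mul_assoc] using (h i).const_mul c

theorem Negligible.mul {e e' : ℝ → ℝ} (h : Negligible e) (h' : Negligible e') :
    Negligible fun T => e T * e' T := fun i => by
  simpa [mul_assoc] using h.tendsto.mul (h' i)

theorem Negligible.mul_eval {e : ℝ → ℝ} (h : Negligible e) (P : ℝ[X]) :
    Negligible fun T => e T * P.eval T := by
  induction P using Polynomial.induction_on' with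
  | add p q hp hq => simpa [mul_add] using hp.add hq
  | monomial n c =>
    intro i
    have := (h (n + i)).const_mul c
    rw [mul_zero] at this
    refine this.congr fun T => ?_
    simp only [Polynomial.eval_monomial]
    ring

theorem Negligible.congr {e e' : ℝ → ℝ} (h : Negligible e) (he : e =ᶠ[atTop] e') :
    Negligible e' := fun i =>
  (h i).congr' (he.mono fun T hT => by rw [hT])

theorem negligible_exp {b : ℝ} (hb : 0 < b) : Negligible fun T => Real.exp (-b * T) := fun i => by
  have := (isLittleO_pow_exp_pos_mul_atTop i hb).tendsto_div_nhds_zero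
  refine this.congr fun T => ?_
  simp only [neg_mul, Real.exp_neg, div_eq_inv_mul]

theorem Negligible.of_abs_le {e e' : ℝ → ℝ} (h : Negligible e)
    (he : ∀ᶠ T in atTop, |e' T| ≤ e T) : Negligible e' := fun i => by
  refine squeeze_zero_norm' ?_ (h i)
  filter_upwards [he, eventually_ge_atTop 0] with T hT h0
  rw [norm_mul, Real.norm_eq_abs, Real.norm_eq_abs, abs_of_nonneg (pow_nonneg h0 i)]
  exact mul_le_mul_of_nonneg_right hT (pow_nonneg h0 i)

/-- `P` is an asymptotic expansion of `f`, up to functions that decay faster than every power. -/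
def HasExpansion (f : ℝ → ℝ) (P : ℝ[X]) : Prop := Negligible fun T => f T - P.eval T

theorem HasExpansion.add {f g : ℝ → ℝ} {P Q : ℝ[X]} (hf : HasExpansion f P)
    (hg : HasExpansion g Q) : HasExpansion (fun T => f T + g T) (P + Q) :=
  (Negligible.add hf hg).congr (.of_forall fun T => by simp only [Polynomial.eval_add]; ring)

theorem HasExpansion.const_mul {f : ℝ → ℝ} {P : ℝ[X]} (c : ℝ) (hf : HasExpansion f P) :
    HasExpansion (fun T => c * f T) (Polynomial.C c * P) :=
  (Negligible.const_mul c hf).congr (.of_forall fun T => by simp; ring)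

theorem HasExpansion.mul {f g : ℝ → ℝ} {P Q : ℝ[X]} (hf : HasExpansion f P)
    (hg : HasExpansion g Q) : HasExpansion (fun T => f T * g T) (P * Q) :=
  (((Negligible.mul_eval hf Q).add (Negligible.mul_eval hg P)).add (Negligible.mul hf hg)).congr
    (.of_forall fun T => by simp only [Polynomial.eval_mul]; ring)

theorem HasExpansion.congr {f g : ℝ → ℝ} {P : ℝ[X]} (hf : HasExpansion f P)
    (h : f =ᶠ[atTop] g) : HasExpansion g P :=
  Negligible.congr hf (h.mono fun T hT => by simp only [hT])

theorem eq_zero_of_tendsto_eval {P : ℝ[X]} (h : Tendsto (fun T => P.eval T) atTop (𝓝 0)) :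
    P = 0 :=
  Polynomial.leadingCoeff_eq_zero.mp ((Polynomial.tendsto_nhds_iff P).mp h).1

/-- The polynomial itself tends to `0`, which only the zero polynomial does. -/
theorem HasExpansion.eq_zero {f : ℝ → ℝ} {P : ℝ[X]} (hf : HasExpansion f P)
    (h : Tendsto f atTop (𝓝 0)) : P = 0 := by
  refine eq_zero_of_tendsto_eval ?_
  simpa using h.sub (Negligible.tendsto hf)

theorem HasExpansion.unique {f : ℝ → ℝ} {P Q : ℝ[X]} (hP : HasExpansion f P)
    (hQ : HasExpansion f Q) : P = Q := by
  refine sub_eq_zero.mp (HasExpansion.eq_zero (f := fun T => f T + (-1) * f T)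
    ?_ (by simp))
  simpa [sub_eq_add_neg] using hP.add (hQ.const_mul (-1))

/-! ### The asymptotic behaviour of multiple polylogarithms at `1` -/

/-- The value at `1 - exp (-T)` of the multiple polylogarithm of an element of `𝔥`. -/
def polylogValue (h : H) (T : ℝ) : ℝ := evalAt (1 - Real.exp (-T)) (series h)

theorem abs_one_sub_exp_lt {T : ℝ} (hT : 0 < T) : |1 - Real.exp (-T)| < 1 := by
  have h1 := Real.exp_pos (-T)
  have h2 : Real.exp (-T) < 1 := by rw [Real.exp_lt_one_iff]; linarith
  rw [abs_lt]
  constructor <;> linarith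

theorem polylogValue_add (a b : H) :
    polylogValue (a + b) =ᶠ[atTop] fun T => polylogValue a T + polylogValue b T := by
  filter_upwards [eventually_gt_atTop 0] with T hT
  exact evalAt_add (abs_one_sub_exp_lt hT) a b

theorem polylogValue_smul (c : ℚ) (a : H) (T : ℝ) :
    polylogValue (c • a) T = (c : ℝ) * polylogValue a T := by
  rw [polylogValue, evalAt_smul, ← Rat.cast_smul_eq_qsmul ℝ, smul_eq_mul, polylogValue]

theorem polylogValue_shuffle {a b : H} (ha : a ∈ H1) (hb : b ∈ H1) :
    polylogValue (shuffle a b) =ᶠ[atTop] fun T => polylogValue a T * polylogValue b T := by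
  filter_upwards [eventually_gt_atTop 0] with T hT
  exact evalAt_shuffle (abs_one_sub_exp_lt hT) ha hb

theorem polylogValue_y : polylogValue (gen Letter.y) =ᶠ[atTop] fun T => T := by
  filter_upwards [eventually_gt_atTop 0] with T hT
  rw [polylogValue, evalAt_y (abs_one_sub_exp_lt hT), sub_sub_cancel, Real.log_exp, neg_neg]

/-- By Bernoulli the left side is at most `min 1 (n * u)`, which is at most the square root of `n *
u`. -/
theorem one_sub_pow_le {u : ℝ} (h0 : 0 ≤ u) (h1 : u ≤ 1) (n : ℕ) :
    1 - (1 - u) ^ n ≤ (n : ℝ) ^ (1 / 2 : ℝ) * u ^ (1 / 2 : ℝ) := by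
  have hb : 1 - (1 - u) ^ n ≤ n * u := by
    have := one_add_mul_le_pow (a := -u) (by linarith) n
    rw [← sub_eq_add_neg] at this
    linarith
  rw [← Real.mul_rpow (by positivity) h0]
  have hnu : 0 ≤ n * u := by positivity
  rcases le_total (n * u) 1 with h | h
  · refine hb.trans ?_
    simpa using Real.rpow_le_rpow_of_exponent_ge' hnu h (by norm_num) (by norm_num : (1 / 2 : ℝ) ≤ 1)
  · refine le_trans ?_ (Real.one_le_rpow h (by norm_num))
    have : 0 ≤ (1 - u) ^ n := pow_nonneg (by linarith) n
    linarith

/-- With `u = exp (-T)`, the distance to the value at `1` is the sum of the coefficients times `1 -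
(1 - u) ^ n`, hence at most `A * exp (-T / 2)`. -/
theorem hasExpansion_polylogValue_zWord {k : List ℕ} (hk : Admissible k) :
    HasExpansion (polylogValue (zWord k)) (Polynomial.C (mzv k)) := by
  set A := ∑' n, PowerSeries.coeff n (polylog k : ℝ⟦X⟧) * (n : ℝ) ^ (1 / 2 : ℝ) with hA
  refine Negligible.of_abs_le ((negligible_exp (b := 1 / 2) (by norm_num)).const_mul A) ?_
  filter_upwards [eventually_gt_atTop 0] with T hT
  have ht := abs_one_sub_exp_lt hT
  have hu0 := (Real.exp_pos (-T)).le
  have hu1 : Real.exp (-T) ≤ 1 := by rw [Real.exp_le_one_iff]; linarith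
  have s := summable_series (zWord k) ht
  rw [series_zWord hk.1] at s
  have s0 := summable_coeff_polylog hk
  have sA := (summable_coeff_polylog_mul_rpow hk).mul_right (Real.exp (-T) ^ (1 / 2 : ℝ))
  have e : mzv k - polylogValue (zWord k) T =
      ∑' n, PowerSeries.coeff n (polylog k : ℝ⟦X⟧) * (1 - (1 - Real.exp (-T)) ^ n) := by
    rw [polylogValue, evalAt, series_zWord hk.1, mzv_eq_tsum, ← s0.tsum_sub s]
    exact tsum_congr fun n => by ring
  have sd : Summable fun n =>
      PowerSeries.coeff n (polylog k : ℝ⟦X⟧) * (1 - (1 - Real.exp (-T)) ^ n) :=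
    (s0.sub s).congr fun n => by ring
  have hexp : Real.exp (-T) ^ (1 / 2 : ℝ) = Real.exp (-(1 / 2) * T) := by
    rw [← Real.exp_mul]; congr 1; ring
  rw [Polynomial.eval_C, abs_sub_comm, e, abs_of_nonneg, ← hexp, hA, ← tsum_mul_right]
  · refine sd.tsum_le_tsum (fun n => ?_) sA
    rw [mul_assoc]
    exact mul_le_mul_of_nonneg_left (one_sub_pow_le hu0 hu1 n) (coeff_polylog_nonneg k n)
  · refine tsum_nonneg fun n => mul_nonneg (coeff_polylog_nonneg k n) ?_
    have := pow_le_one₀ (n := n) (by linarith : 0 ≤ 1 - Real.exp (-T)) (by linarith)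
    linarith

theorem HasExpansion.polylogValue_add {a b : H} {P Q : ℝ[X]}
    (ha : HasExpansion (polylogValue a) P) (hb : HasExpansion (polylogValue b) Q) :
    HasExpansion (polylogValue (a + b)) (P + Q) :=
  (ha.add hb).congr (MZV.polylogValue_add a b).symm

theorem HasExpansion.polylogValue_smul {a : H} {P : ℝ[X]} (c : ℚ)
    (ha : HasExpansion (polylogValue a) P) :
    HasExpansion (polylogValue (c • a)) (Polynomial.C (c : ℝ) * P) :=
  (ha.const_mul c).congr (.of_forall fun T => (MZV.polylogValue_smul c a T).symm)

theorem polylogValue_zero : polylogValue 0 = fun _ => 0 := by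
  funext T
  simp [polylogValue, evalAt]

theorem hasExpansion_zero : HasExpansion (polylogValue 0) 0 := by
  rw [polylogValue_zero]
  intro i
  simp

theorem hasExpansion_polylogValue_H0 {h : H} (hh : h ∈ H0) :
    HasExpansion (polylogValue h) (Polynomial.C (ofExponents mzv h)) := by
  replace hh := H0_le_span_zWord hh
  induction hh using Submodule.span_induction with
  | zero => simpa using hasExpansion_zero
  | add a b _ _ ha hb => simpa using ha.polylogValue_add hb
  | smul c a _ ha =>
    rw [map_smul, ← Rat.cast_smul_eq_qsmul ℝ c (ofExponents mzv a), smul_eq_mul, Polynomial.C_mul]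
    exact ha.polylogValue_smul c
  | mem _ h =>
    obtain ⟨k, hk, rfl⟩ := h
    rw [ofExponents_zWord _ hk.1]
    exact hasExpansion_polylogValue_zWord hk

theorem hasExpansion_polylogValue_y : HasExpansion (polylogValue (gen Letter.y)) Polynomial.X :=
  HasExpansion.congr (f := fun T => T) (fun i => by simp) polylogValue_y.symm

/-- The elements of `𝔥¹` whose multiple polylogarithms have an expansion at `1`. -/
def expandable : Submodule ℚ H where
  carrier := {h | h ∈ H1 ∧ ∃ P, HasExpansion (polylogValue h) P}
  zero_mem' := ⟨zero_mem _, 0, hasExpansion_zero⟩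
  add_mem' := fun ⟨ha, P, hP⟩ ⟨hb, Q, hQ⟩ => ⟨add_mem ha hb, P + Q, hP.polylogValue_add hQ⟩
  smul_mem' := fun c _ ⟨ha, _, hP⟩ => ⟨Submodule.smul_mem _ c ha, _, hP.polylogValue_smul c⟩

theorem exists_hasExpansion (w : H1) : ∃ P, HasExpansion (polylogValue w) P := by
  have : H1 ≤ expandable := by
    refine H1_le_of_shuffle_closed _
      (fun h hh => ⟨H0_le_H1 hh, _, hasExpansion_polylogValue_H0 hh⟩) ?_
    rintro h ⟨hh, P, hP⟩
    exact ⟨shuffle_mem_H1 yH1 ⟨h, hh⟩, _, (hasExpansion_polylogValue_y.mul hP).congr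
      (polylogValue_shuffle gen_y_mem_H1 hh).symm⟩
  exact (this w.2).2

/-- The shuffle-regularized map: the expansion at `1` of the multiple polylogarithm, as a
polynomial in `-log (1 - t)`. -/
def regularization : H1 →ₗ[ℚ] ℝ[X] where
  toFun w := (exists_hasExpansion w).choose
  map_add' a b := (exists_hasExpansion (a + b)).choose_spec.unique
    ((exists_hasExpansion a).choose_spec.polylogValue_add (exists_hasExpansion b).choose_spec)
  map_smul' c a := by
    have := (exists_hasExpansion (c • a)).choose_spec.unique
      ((exists_hasExpansion a).choose_spec.polylogValue_smul c)
    rw [this, RingHom.id_apply, ← Rat.cast_smul_eq_qsmul ℝ, Polynomial.smul_eq_C_mul]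

theorem hasExpansion_regularization (w : H1) :
    HasExpansion (polylogValue w) (regularization w) :=
  (exists_hasExpansion w).choose_spec

theorem isShuffleRegularization_regularization : IsShuffleRegularization regularization where
  map_shuffle a b := (hasExpansion_regularization (shuffle1 a b)).unique
    (((hasExpansion_regularization a).mul (hasExpansion_regularization b)).congr
      (polylogValue_shuffle a.2 b.2).symm)
  map_y := (hasExpansion_regularization yH1).unique hasExpansion_polylogValue_y
  map_incl w := (hasExpansion_regularization (incl w)).unique (hasExpansion_polylogValue_H0 w.2)

/-- The elements where both maps agree contain `𝔥⁰` and are stable under shuffling with `y`. -/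
theorem IsShuffleRegularization.unique {φ ψ : H1 →ₗ[ℚ] ℝ[X]} (hφ : IsShuffleRegularization φ)
    (hψ : IsShuffleRegularization ψ) : φ = ψ := by
  have : H1 ≤ (LinearMap.ker (φ - ψ)).map H1.subtype := by
    refine H1_le_of_shuffle_closed _ (fun h hh => ?_) ?_
    · refine ⟨incl ⟨h, hh⟩, ?_, rfl⟩
      rw [SetLike.mem_coe, LinearMap.mem_ker, LinearMap.sub_apply, hφ.map_incl, hψ.map_incl,
        sub_self]
    · rintro _ ⟨w, hw, rfl⟩
      refine ⟨shuffle1 yH1 w, ?_, rfl⟩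
      rw [SetLike.mem_coe, LinearMap.mem_ker, LinearMap.sub_apply] at hw ⊢
      rw [hφ.map_shuffle, hψ.map_shuffle, hφ.map_y, hψ.map_y, ← mul_sub, hw, mul_zero]
  refine LinearMap.ext fun w => ?_
  obtain ⟨v, hv, e⟩ := this w.2
  obtain rfl : v = w := Subtype.ext e
  exact sub_eq_zero.mp hv

/-! ### The extended double shuffle relation -/

theorem tendsto_one_sub_exp : Tendsto (fun T => 1 - Real.exp (-T)) atTop (𝓝[<] 1) := by
  refine tendsto_nhdsWithin_iff.mpr ⟨?_, .of_forall fun T => ?_⟩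
  · simpa using (tendsto_const_nhds (x := (1 : ℝ))).sub
      (Real.tendsto_exp_atBot.comp tendsto_neg_atTop_atBot)
  · simp [Real.exp_pos]

/-- Abel's limit theorem, along `t = 1 - exp (-T)`. -/
theorem tendsto_evalAt_of_partialSum {f : ℝ⟦X⟧} {l : ℝ}
    (h : Tendsto (fun M => partialSum M f) atTop (𝓝 l)) :
    Tendsto (fun T => evalAt (1 - Real.exp (-T)) f) atTop (𝓝 l) := by
  simp only [partialSum_apply] at h
  exact (Real.tendsto_tsum_powerSeries_nhdsWithin_lt h).comp tendsto_one_sub_exp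

theorem truncation_isBigO {h : H} (hh : h ∈ H1) :
    (fun M => truncation M h) =O[atTop] fun M : ℕ => (M : ℝ) ^ (1 / 4 : ℝ) := by
  replace hh := H1_le_span_zWord hh
  induction hh using Submodule.span_induction with
  | zero => simpa using Asymptotics.isBigO_zero _ _
  | add a b _ _ ha hb => simpa using ha.add hb
  | smul c a _ ha =>
    refine (ha.const_mul_left (c : ℝ)).congr_left fun M => ?_
    rw [map_smul, ← Rat.cast_smul_eq_qsmul ℝ, smul_eq_mul]
  | mem _ h =>
    obtain ⟨k, hk, rfl⟩ := h
    obtain ⟨C, -, hC⟩ := exists_partialSum_polylog_le k hk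
    refine Asymptotics.IsBigO.of_bound C (.of_forall fun M => ?_)
    rw [truncation_apply, series_zWord hk, Real.norm_of_nonneg (partialSum_polylog_nonneg k M),
      Real.norm_of_nonneg (by positivity)]
    exact hC M

/-- On the tail `n ≥ M` the weight `n ^ (1/2)` is at least `M ^ (1/2)`, and the weighted series
converges. -/
theorem truncation_sub_isBigO {h : H} (hh : h ∈ H0) :
    (fun M => truncation M h - ofExponents mzv h) =O[atTop]
      fun M : ℕ => (M : ℝ) ^ (-(1 / 2) : ℝ) := by
  replace hh := H0_le_span_zWord hh
  induction hh using Submodule.span_induction with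
  | zero => simpa using Asymptotics.isBigO_zero _ _
  | add a b _ _ ha hb =>
    refine (ha.add hb).congr_left fun M => ?_
    rw [map_add, map_add]
    ring
  | smul c a _ ha =>
    refine (ha.const_mul_left (c : ℝ)).congr_left fun M => ?_
    rw [map_smul, map_smul, ← Rat.cast_smul_eq_qsmul ℝ, ← Rat.cast_smul_eq_qsmul ℝ, smul_eq_mul,
      smul_eq_mul]
    ring
  | mem _ h =>
    obtain ⟨k, hk, rfl⟩ := h
    have s := summable_coeff_polylog hk
    have sA := summable_coeff_polylog_mul_rpow hk
    refine Asymptotics.IsBigO.of_bound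
      (∑' n, PowerSeries.coeff n (polylog k : ℝ⟦X⟧) * (n : ℝ) ^ (1 / 2 : ℝ)) ?_
    filter_upwards [eventually_ge_atTop 1] with M hM
    have hM' : (0 : ℝ) < M := by exact_mod_cast hM
    rw [truncation_apply, series_zWord hk.1, ofExponents_zWord _ hk.1, mzv_eq_tsum,
      partialSum_apply, ← s.sum_add_tsum_nat_add M, sub_add_cancel_left, norm_neg,
      Real.norm_of_nonneg (tsum_nonneg fun n => coeff_polylog_nonneg k _),
      Real.norm_of_nonneg (by positivity)]
    have hle : ∀ n, PowerSeries.coeff (n + M) (polylog k : ℝ⟦X⟧) ≤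
        PowerSeries.coeff (n + M) (polylog k : ℝ⟦X⟧) * ((n + M : ℕ) : ℝ) ^ (1 / 2 : ℝ) *
          (M : ℝ) ^ (-(1 / 2) : ℝ) := by
      intro n
      rw [mul_assoc]
      refine le_mul_of_one_le_right (coeff_polylog_nonneg k _) ?_
      rw [Real.rpow_neg hM'.le, ← div_eq_mul_inv, one_le_div (by positivity)]
      exact Real.rpow_le_rpow hM'.le (by push_cast; linarith [Nat.cast_nonneg (α := ℝ) n])
        (by norm_num)
    have sA' := (summable_nat_add_iff M).mpr sA
    refine (((summable_nat_add_iff M).mpr s).tsum_le_tsum hle (sA'.mul_right _)).trans ?_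
    rw [tsum_mul_right]
    refine mul_le_mul_of_nonneg_right ?_ (by positivity)
    rw [← sA.sum_add_tsum_nat_add M]
    exact le_add_of_nonneg_left (Finset.sum_nonneg fun n _ =>
      mul_nonneg (coeff_polylog_nonneg k n) (by positivity))

/-- Abel's theorem is applied to the difference, whose truncation factors as that of `a` times the
error of `b`, of order `M ^ (1/4 - 1/2)`. The two parts need not converge separately. -/
theorem tendsto_polylogValue_harmonic_sub {a b : H} (ha : a ∈ H1) (hb : b ∈ H0) :
    Tendsto (fun T => polylogValue (harmonicAux a b) T - ofExponents mzv b * polylogValue a T)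
      atTop (𝓝 0) := by
  have h1 : Tendsto (fun M => partialSum M
      (series (harmonicAux a b) - ofExponents mzv b • series a)) atTop (𝓝 0) := by
    have hO := (truncation_isBigO ha).mul (truncation_sub_isBigO hb)
    have h0 : Tendsto (fun M : ℕ => (M : ℝ) ^ (1 / 4 : ℝ) * (M : ℝ) ^ (-(1 / 2) : ℝ)) atTop
        (𝓝 0) := by
      refine ((tendsto_rpow_neg_atTop (y := 1 / 4) (by norm_num)).comp
        tendsto_natCast_atTop_atTop).congr' ?_
      filter_upwards [eventually_ge_atTop 1] with M hM
      have hM' : (0 : ℝ) < M := by exact_mod_cast hM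
      rw [← Real.rpow_add hM', Function.comp_apply]
      norm_num
    refine (hO.trans_tendsto h0).congr fun M => ?_
    rw [map_sub, map_smul, ← truncation_apply, ← truncation_apply,
      truncation_harmonic M ha (H0_le_H1 hb), smul_eq_mul]
    ring
  refine (tendsto_evalAt_of_partialSum h1).congr' ?_
  filter_upwards [eventually_gt_atTop 0] with T hT
  have ht := abs_one_sub_exp_lt hT
  rw [polylogValue, polylogValue, evalAt, evalAt, evalAt, ← tsum_mul_left,
    ← (summable_series _ ht).tsum_sub ((summable_series a ht).mul_left _)]
  refine tsum_congr fun n => ?_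
  rw [map_sub, map_smul, smul_eq_mul]
  ring

theorem regularization_harmonic_sub_shuffle (w₁ : H1) (w₂ : H0) :
    regularization (harmonic1 w₁ (incl w₂) - shuffle1 w₁ (incl w₂)) = 0 := by
  have h1 : Tendsto
      (fun T => polylogValue (harmonic1 w₁ (incl w₂) : H) T - ofExponents mzv w₂ * polylogValue w₁ T)
      atTop (𝓝 0) := tendsto_polylogValue_harmonic_sub w₁.2 w₂.2
  have h2 := (hasExpansion_regularization (harmonic1 w₁ (incl w₂))).add
    ((hasExpansion_regularization w₁).const_mul (-ofExponents mzv w₂))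
  have h3 := h2.eq_zero (h1.congr fun T => by ring)
  rw [map_sub, isShuffleRegularization_regularization.map_shuffle,
    isShuffleRegularization_regularization.map_incl, Z_apply]
  rw [Polynomial.C_neg, neg_mul, ← sub_eq_add_neg, mul_comm (Polynomial.C _)] at h3
  exact h3

end MZV

end

theorem theorem2p5 :
    -- the series involved converge (absolutely)
    (∀ k : List ℕ, MZV.Admissible k → Summable (MZV.mzvTerm k)) ∧
    (∀ t : MZV.Triple, t.Convergent → Summable (MZV.rootTerm t.point)) ∧
    -- the partial fraction decomposition
    (∀ (α β : ℕ) (X Y : ℝ), 1 ≤ α → 1 ≤ β → X ≠ 0 → Y ≠ 0 → X + Y ≠ 0 →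
      1 / (X ^ α * Y ^ β) =
        ∑ τ ∈ Finset.range β,
            ((α - 1 + τ).choose τ : ℝ) * (1 / ((X + Y) ^ (α + τ) * Y ^ (β - τ))) +
          ∑ τ ∈ Finset.range α,
            ((β - 1 + τ).choose τ : ℝ) * (1 / ((X + Y) ^ (β + τ) * X ^ (α - τ)))) ∧
    -- the relations it yields hold among zeta values of root systems
    (∀ e ∈ MZV.pfdRelations, MZV.symEval e = 0) ∧
    -- multiple zeta values and their products are such zeta values
    (∀ k : List ℕ, MZV.Admissible k → MZV.Triple.zeta ⟨k, [], []⟩ = MZV.mzv k) ∧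
    (∀ p q : List ℕ, MZV.Admissible p → MZV.Admissible q →
      MZV.Triple.zeta ⟨[], p, q⟩ = MZV.mzv p * MZV.mzv q) ∧
    -- the shuffle relation is a formal consequence of those relations alone
    (∀ p q : List ℕ, MZV.Admissible p → MZV.Admissible q →
      MZV.sym [] p q - MZV.symOf (MZV.shuffle (MZV.zWord p) (MZV.zWord q)) ∈
        MZV.pfdRelations) ∧
    -- the shuffle homomorphism property, and its form as a zeta value of a root system
    (∀ w₁ w₂ : MZV.H0, MZV.Z (MZV.shuffle0 w₁ w₂) = MZV.Z w₁ * MZV.Z w₂) ∧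
    (∀ (p q : List ℕ) (w₁ w₂ : MZV.H0), MZV.Admissible p → MZV.Admissible q →
      (w₁ : MZV.H) = MZV.zWord p → (w₂ : MZV.H) = MZV.zWord q →
      MZV.Z (MZV.shuffle0 w₁ w₂) = MZV.Triple.zeta ⟨[], p, q⟩) ∧
    -- the regularized map exists, is unique, and satisfies the extended double shuffle relation
    ∃ Zreg : MZV.H1 →ₗ[ℚ] Polynomial ℝ,
      MZV.IsShuffleRegularization Zreg ∧
      (∀ φ : MZV.H1 →ₗ[ℚ] Polynomial ℝ, MZV.IsShuffleRegularization φ → φ = Zreg) ∧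
      ∀ (w₁ : MZV.H1) (w₂ : MZV.H0),
        Zreg (MZV.harmonic1 w₁ (MZV.incl w₂) - MZV.shuffle1 w₁ (MZV.incl w₂)) = 0 := by
  refine ⟨fun k => MZV.summable_mzvTerm, fun t => MZV.summable_rootTerm,
    fun α β X Y hα hβ => MZV.one_div_pow_mul_pow hα hβ, fun e => MZV.symEval_eq_zero,
    fun k _ => MZV.zeta_eq_mzv k, fun p q _ _ => MZV.zeta_eq_mzv_mul_mzv p q, ?_,
    MZV.Z_shuffle0, ?_, MZV.regularization, MZV.isShuffleRegularization_regularization,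
    fun φ hφ => hφ.unique MZV.isShuffleRegularization_regularization,
    MZV.regularization_harmonic_sub_shuffle⟩
  · intro p q hp hq
    have := MZV.sym_sub_symOf_mem (MZV.convergent_nil_iff.mpr ⟨hp, hq⟩)
    rwa [MZV.zWord_nil, one_mul] at this
  · intro p q w₁ w₂ hp hq h₁ h₂
    rw [MZV.Z_apply, ← MZV.ofExponents_mzv_shuffle_zWord hp hq, ← h₁, ← h₂]
    rfl
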